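/- For $p,\lambda>0$ let $E_{p,\lambda}=\{(x,y,z)\in\mathbb C^3 : (|x|^{2p}+|y|^2)^{1/\lambda}+|z|^2<1\}$. Let $B(w,w)=\sum_j|e_j(w)|^2$ be its Bergman kernel on the diagonal, where $(e_j)$ is an orthonormal basis of the Hilbert space of holomorphic functions on $E_{p,\lambda}$ that are square integrable with respect to Lebesgue measure. Then for every $p,\lambda>0$ the kernel satisfies $B(w,w)>0$ on $E_{p,\lambda}$, the function $\log B(w,w)$ is smooth there, and the matrix $g_{i\bar j}=\frac{\partial^2\log B(w,w)}{\partial w_i\,\partial\overline{w_j}}$ is positive definite at every point, so that it defines a Hermitian metric $g$ (the Bergman metric); and its curvature tensor $$R_{i\bar jk\bar l}=-\frac{\partial^2 g_{i\bar j}}{\partial w_k\,\partial\overline{w_l}}+\sum_{a,b=1}^{3}g^{b\bar a}\,\frac{\partial g_{i\bar a}}{\partial w_k}\,\frac{\partial g_{b\bar j}}{\partial\overline{w_l}}$$ (where $(g^{b\bar a})$ denotes the inverse of the metric, $\sum_{a}g^{b\bar a}g_{c\bar a}=\delta_{bc}$) is bounded with respect to $g$: there is a constant $C$, depending only on $p$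 and $\lambda$, such that $$|R(\xi,\bar\eta,\zeta,\bar\theta)|\le C\,|\xi|_g\,|\eta|_g\,|\zeta|_g\,|\theta|_g$$ for every point $w\in E_{p,\lambda}$ and all $\xi,\eta,\zeta,\theta\in\mathbb C^3$, where $R(\xi,\bar\eta,\zeta,\bar\theta)=\sum_{i,j,k,l}R_{i\bar jk\bar l}\,\xi_i\overline{\eta_j}\zeta_k\overline{\theta_l}$ and $|\xi|_g^2=\sum_{i,j}g_{i\bar j}\,\xi_i\overline{\xi_j}$. -/

import Mathlib

open MeasureTheory
open scoped ContDiff ComplexConjugate ComplexOrder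

noncomputable section

/-- The Bergman space `A²(Ω)` of a domain `Ω ⊆ ℂⁿ`: the classes in `L²(Ω)` (with respect to Lebesgue
measure) that have a representative holomorphic on `Ω`. The holomorphic `(n,0)`-form
`f dz₁ ∧ ⋯ ∧ dzₙ` is identified with its coefficient `f`. -/
def bergmanSpace {n : ℕ} (Ω : Set (Fin n → ℂ)) :
    Submodule ℂ (Lp ℂ 2 ((volume : Measure (Fin n → ℂ)).restrict Ω)) where
  carrier := {f | ∃ F : (Fin n → ℂ) → ℂ, DifferentiableOn ℂ F Ω ∧ f =ᵐ[volume.restrict Ω] F}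
  zero_mem' := ⟨0, differentiableOn_const 0, Lp.coeFn_zero ℂ 2 _⟩
  add_mem' := by
    rintro f g ⟨F, hF, hfF⟩ ⟨G, hG, hgG⟩
    exact ⟨F + G, hF.add hG, (Lp.coeFn_add f g).trans (hfF.add hgG)⟩
  smul_mem' := by
    rintro c f ⟨F, hF, hfF⟩
    exact ⟨c • F, hF.const_smul c, (Lp.coeFn_smul c f).trans (hfF.const_smul c)⟩

/-- The holomorphic representative of an element of the Bergman space (on an open set `Ω` its values
on `Ω` are uniquely determined). -/
def bergmanSpace.toFun {n : ℕ} {Ω : Set (Fin n → ℂ)} (f : bergmanSpace Ω) : (Fin n → ℂ) → ℂ :=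
  Classical.choose f.2

/-- An orthonormal basis, that is, a maximal orthonormal set, of the Hilbert space `A²(Ω)`. -/
def bergmanBasis {n : ℕ} (Ω : Set (Fin n → ℂ)) : Set (bergmanSpace Ω) :=
  Classical.choose (exists_maximal_orthonormal (orthonormal_empty ℂ (bergmanSpace Ω)))

theorem bergmanBasis_spec {n : ℕ} (Ω : Set (Fin n → ℂ)) :
    Orthonormal ℂ (Subtype.val : bergmanBasis Ω → bergmanSpace Ω) ∧
      ∀ u ⊇ bergmanBasis Ω, Orthonormal ℂ (Subtype.val : u → bergmanSpace Ω) →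
        u = bergmanBasis Ω :=
  (Classical.choose_spec
    (exists_maximal_orthonormal (orthonormal_empty ℂ (bergmanSpace Ω)))).2

/-- The Bergman kernel `B(z, w) = ∑ⱼ eⱼ(z) conj (eⱼ(w))`, where `(eⱼ)` is an orthonormal basis of
`A²(Ω)`. -/
def bergmanKernel {n : ℕ} (Ω : Set (Fin n → ℂ)) (z w : Fin n → ℂ) : ℂ :=
  ∑' e : bergmanBasis Ω, bergmanSpace.toFun e.1 z * conj (bergmanSpace.toFun e.1 w)

/-- The Wirtinger derivative `∂F/∂zᵢ = (∂F/∂xᵢ - √-1 ∂F/∂yᵢ) / 2`, where `zᵢ = xᵢ + √-1 yᵢ`. -/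
def wirtinger {n : ℕ} (i : Fin n) (F : (Fin n → ℂ) → ℂ) (z : Fin n → ℂ) : ℂ :=
  (fderiv ℝ F z (Pi.single i 1) - Complex.I * fderiv ℝ F z (Pi.single i Complex.I)) / 2

/-- The Wirtinger derivative `∂F/∂z̄ᵢ = (∂F/∂xᵢ + √-1 ∂F/∂yᵢ) / 2`, where `zᵢ = xᵢ + √-1 yᵢ`. -/
def wirtingerBar {n : ℕ} (i : Fin n) (F : (Fin n → ℂ) → ℂ) (z : Fin n → ℂ) : ℂ :=
  (fderiv ℝ F z (Pi.single i 1) + Complex.I * fderiv ℝ F z (Pi.single i Complex.I)) / 2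

/-- The function `z ↦ log B(z, z)`. -/
def logBergmanKernel {n : ℕ} (Ω : Set (Fin n → ℂ)) (z : Fin n → ℂ) : ℝ :=
  Real.log (bergmanKernel Ω z z).re

/-- The matrix of components `g i j = ∂² log B(z, z) / ∂zᵢ ∂z̄ⱼ` of the Bergman metric. -/
def bergmanMetric {n : ℕ} (Ω : Set (Fin n → ℂ)) (z : Fin n → ℂ) : Matrix (Fin n) (Fin n) ℂ :=
  Matrix.of fun i j => wirtinger i (wirtingerBar j fun w => (logBergmanKernel Ω w : ℂ)) z

/-- The components of the curvature tensor of the Chern connection of a Hermitian metric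
`g i j = g(∂/∂zᵢ, ∂/∂z̄ⱼ)`:
`R i j k l = - ∂²(g i j) / ∂zₖ ∂z̄ₗ + ∑ a, ∑ b, (g⁻¹ a b) (∂(g i a) / ∂zₖ) (∂(g b j) / ∂z̄ₗ)`,
where the second and the fourth index are the conjugate ones and `g⁻¹` is the inverse matrix. -/
def chernCurvature {n : ℕ} (g : (Fin n → ℂ) → Matrix (Fin n) (Fin n) ℂ) (z : Fin n → ℂ)
    (i j k l : Fin n) : ℂ :=
  -wirtinger k (wirtingerBar l fun w => g w i j) z +
    ∑ a, ∑ b, (g z)⁻¹ a b * wirtinger k (fun w => g w i a) z * wirtingerBar l (fun w => g w b j) z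

/-- The value `R(ξ, η̄, ζ, θ̄)` of the curvature tensor at the point `z` on the `(1,0)`-vectors
`ξ = ∑ ξᵢ ∂/∂zᵢ`, `η`, `ζ`, `θ`. -/
def chernCurvatureForm {n : ℕ} (g : (Fin n → ℂ) → Matrix (Fin n) (Fin n) ℂ)
    (z ξ η ζ θ : Fin n → ℂ) : ℂ :=
  ∑ i, ∑ j, ∑ k, ∑ l, chernCurvature g z i j k l * ξ i * conj (η j) * ζ k * conj (θ l)

/-- The length `|ξ|_g = g(ξ, ξ̄)^(1/2)` of the `(1,0)`-vector `ξ = ∑ ξᵢ ∂/∂zᵢ` at the point `z`. -/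
def hermitianLength {n : ℕ} (g : (Fin n → ℂ) → Matrix (Fin n) (Fin n) ℂ)
    (z ξ : Fin n → ℂ) : ℝ :=
  √(∑ i, ∑ j, g z i j * ξ i * conj (ξ j)).re

/-- The curvature tensor of the metric `g` is bounded on `Ω`: its norm with respect to `g` is at most
a constant that does not depend on the point. -/
def HasBoundedCurvature {n : ℕ} (g : (Fin n → ℂ) → Matrix (Fin n) (Fin n) ℂ)
    (Ω : Set (Fin n → ℂ)) : Prop :=
  ∃ C : ℝ, ∀ z ∈ Ω, ∀ ξ η ζ θ : Fin n → ℂ,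
    ‖chernCurvatureForm g z ξ η ζ θ‖ ≤
      C * (hermitianLength g z ξ * hermitianLength g z η *
        hermitianLength g z ζ * hermitianLength g z θ)

/-- The domain `E_{p,lam} = {(x, y, z) ∈ ℂ³ : (|x|^{2p} + |y|²)^{1/lam} + |z|² < 1}`. -/
def domainE (p lam : ℝ) : Set (Fin 3 → ℂ) :=
  {v | (‖v 0‖ ^ (2 * p) + ‖v 1‖ ^ 2) ^ (1 / lam) + ‖v 2‖ ^ 2 < 1}

end

/-! ### Holomorphic maps in several variables: Cauchy estimates, uniform limits, smoothness. -/

section SeveralComplexVariables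

open Metric Filter Topology

variable {E F : Type*} [NormedAddCommGroup E] [NormedSpace ℂ E] [NormedAddCommGroup F]
  [NormedSpace ℂ F]

/-- Cauchy estimate for the Fréchet derivative of a holomorphic map. -/
theorem norm_fderiv_le_of_norm_le_on_ball {f : E → F} {c : E} {R C : ℝ}
    (hd : DifferentiableOn ℂ f (ball c R)) (hC : ∀ z ∈ ball c R, ‖f z‖ ≤ C) (hR : 0 < R) :
    ‖fderiv ℂ f c‖ ≤ 2 * C / R := by
  refine Complex.norm_fderiv_le_div_of_mapsTo_ball hd (fun z hz => ?_) hR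
  rw [mem_closedBall, dist_eq_norm]
  linarith [norm_sub_le (f z) (f c), hC z hz, hC c (mem_ball_self hR)]

/-- Quadratic bound for the first order Taylor remainder of a holomorphic map. -/
theorem norm_sub_sub_fderiv_le_of_norm_le_on_ball {f : E → F} {c z : E} {R C : ℝ}
    (hd : DifferentiableOn ℂ f (ball c R)) (hC : ∀ z ∈ ball c R, ‖f z‖ ≤ C) (hz : z ∈ ball c R) :
    ‖f z - f c - fderiv ℂ f c (z - c)‖ ≤ 4 * C * (‖z - c‖ / R) ^ 2 := by
  have hR : 0 < R := nonempty_ball.mp ⟨_, hz⟩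
  have hf := (hd.differentiableAt (ball_mem_nhds c hR)).hasFDerivAt
  have hF := norm_fderiv_le_of_norm_le_on_ball hd hC hR
  -- Schwarz lemma for a map that differs from its central value by `o(‖w - c‖)`: `n = 1` gives the
  -- exponent 2, and `4 * C` is `C + 2 * C + C`, from the value, the linear term and the value at
  -- the center.
  have key := Complex.dist_le_mul_div_pow_of_mapsTo_ball_of_isLittleO (n := 1) (R₂ := 4 * C)
    (f := fun w => f w - fderiv ℂ f c (w - c)) (hd.sub (by fun_prop)) (fun w hw => ?_) ?_ hz
  · rw [dist_eq_norm, dist_eq_norm] at key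
    refine le_trans (le_of_eq ?_) key
    congr 1
    simp only [sub_self, map_zero, sub_zero]
    abel
  · have h1 : ‖fderiv ℂ f c (w - c)‖ ≤ 2 * C := by
      refine (ContinuousLinearMap.le_opNorm _ _).trans ?_
      have h2 : ‖w - c‖ ≤ R := by
        rw [← dist_eq_norm]
        exact (mem_ball.mp hw).le
      calc _ ≤ 2 * C / R * R := by
              gcongr
              exact (norm_nonneg _).trans hF
        _ = 2 * C := by field_simp
    rw [mem_closedBall, dist_eq_norm]
    simp only [sub_self, map_zero, sub_zero]
    have h3 := norm_sub_le (f w - fderiv ℂ f c (w - c)) (f c)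
    have h4 := norm_sub_le (f w) (fderiv ℂ f c (w - c))
    linarith [hC w hw, hC c (mem_ball_self hR)]
  · simp only [sub_self, map_zero, sub_zero, pow_one]
    have := hf.isLittleO.norm_right
    refine this.congr_left fun w => ?_
    abel

/-- A uniform limit of holomorphic maps is complex differentiable. -/
theorem differentiableAt_of_tendstoUniformlyOn_ball [CompleteSpace F] {ι : Type*} {l : Filter ι}
    [NeBot l] {f : ι → E → F} {g : E → F} {c : E} {R : ℝ} (hR : 0 < R)
    (hd : ∀ n, DifferentiableOn ℂ (f n) (ball c R)) (hf : TendstoUniformlyOn f g l (ball c R)) :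
    DifferentiableAt ℂ g c := by
  have hsub : ∀ z ∈ ball c (R / 2), ball z (R / 2) ⊆ ball c R := fun z hz =>
    ball_subset_ball' (by linarith [mem_ball.mp hz])
  have hdat : ∀ n, ∀ z ∈ ball c (R / 2), DifferentiableAt ℂ (f n) z := fun n z hz =>
    (hd n).differentiableAt (isOpen_ball.mem_nhds (ball_subset_ball (by linarith) hz))
  have hC : UniformCauchySeqOn (fun n z => fderiv ℂ (f n) z) l (ball c (R / 2)) := by
    intro u hu
    obtain ⟨ε, hε, hu⟩ := Metric.mem_uniformity_dist.mp hu
    -- The Cauchy estimate on balls of radius `R / 2` turns `ε * R / 8` into `ε / 2`.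
    have := hf.uniformCauchySeqOn _ (Metric.dist_mem_uniformity (show 0 < ε * R / 8 by positivity))
    filter_upwards [this] with mn hmn z hz
    apply hu
    rw [dist_eq_norm, ← fderiv_sub (hdat _ z hz) (hdat _ z hz)]
    refine (norm_fderiv_le_of_norm_le_on_ball (R := R / 2) (C := ε * R / 8) ?_ ?_
      (by positivity)).trans_lt ?_
    · exact ((hd _).sub (hd _)).mono (hsub z hz)
    · intro w hw
      have := hmn w (hsub z hz hw)
      simp only [dist_eq_norm] at this
      exact this.le
    · field_simp
      norm_num
  have hlim : ∀ z ∈ ball c (R / 2), ∃ L, Tendsto (fun n => fderiv ℂ (f n) z) l (𝓝 L) :=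
    fun z hz => cauchy_map_iff_exists_tendsto.mp (hC.cauchy_map hz)
  choose! g' hg' using hlim
  have hU := hC.tendstoUniformlyOn_of_tendsto hg'
  exact (hasFDerivAt_of_tendstoUniformlyOn isOpen_ball hU
    (fun n z hz => (hdat n z hz).hasFDerivAt)
    (fun z hz => hf.tendsto_at (ball_subset_ball (by linarith) hz))
    (mem_ball_self (by positivity))).differentiableAt

/-- Directional derivatives of a holomorphic map are holomorphic. -/
theorem DifferentiableOn.fderiv_apply_of_isOpen [CompleteSpace F] {f : E → F} {s : Set E}
    (hf : DifferentiableOn ℂ f s) (hs : IsOpen s) (v : E) :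
    DifferentiableOn ℂ (fun z => fderiv ℂ f z v) s := by
  intro c hc
  apply DifferentiableAt.differentiableWithinAt
  obtain ⟨R, hR, hRs⟩ : ∃ R > 0, ∀ z ∈ ball c R, z ∈ s ∧ ‖f z‖ ≤ ‖f c‖ + 1 := by
    apply Metric.eventually_nhds_iff_ball.mp
    refine (hs.eventually_mem hc).and ?_
    exact ((hf.continuousOn.continuousAt (hs.mem_nhds hc)).norm.eventually_lt_const
      (lt_add_one _)).mono fun _ h => h.le
  have hfR : DifferentiableOn ℂ f (ball c R) := hf.mono fun z hz => (hRs z hz).1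
  set C := ‖f c‖ + 1 with hCdef
  have hCpos : 0 < C := by positivity
  -- The directional derivative is the uniform limit of the difference quotients with steps `t n`;
  -- this `ε` keeps `z + t n • v` inside `ball c R` for `z` in the half ball, and the quadratic
  -- Taylor remainder makes the convergence uniform.
  set ε : ℝ := R / (4 * (‖v‖ + 1)) with hε
  have hεpos : 0 < ε := by positivity
  let t : ℕ → ℂ := fun n => ((ε / (n + 1) : ℝ) : ℂ)
  have ht0 : ∀ n, t n ≠ 0 := fun n => by
    simp only [t, ne_eq, Complex.ofReal_eq_zero]
    positivity
  have htn : ∀ n, ‖t n‖ = ε / (n + 1) := fun n => by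
    simp only [t, Complex.norm_real, Real.norm_eq_abs]
    exact abs_of_pos (by positivity)
  have htv : ∀ n, ‖t n • v‖ < R / 2 := by
    intro n
    rw [norm_smul, htn]
    have h1 : ε / (n + 1) ≤ ε := div_le_self hεpos.le (by linarith [n.cast_nonneg (α := ℝ)])
    have h2 : ε * (‖v‖ + 1) = R / 4 := by rw [hε]; field_simp
    nlinarith [norm_nonneg v]
  have hmem : ∀ n, ∀ z ∈ ball c (R / 2), z + t n • v ∈ ball c R := by
    intro n z hz
    rw [mem_ball, dist_eq_norm] at hz ⊢
    calc ‖z + t n • v - c‖ = ‖(z - c) + t n • v‖ := by congr 1; abel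
      _ ≤ ‖z - c‖ + ‖t n • v‖ := norm_add_le _ _
      _ < R := by linarith [htv n]
  refine differentiableAt_of_tendstoUniformlyOn_ball (l := atTop) (R := R / 2)
    (f := fun n z => (t n)⁻¹ • (f (z + t n • v) - f z)) (by positivity) (fun n => ?_) ?_
  · refine DifferentiableOn.const_smul (DifferentiableOn.sub ?_ ?_) _
    · exact hfR.comp (by fun_prop) (hmem n)
    · exact hfR.mono (ball_subset_ball (by linarith))
  · rw [Metric.tendstoUniformlyOn_iff]
    intro η hη
    have hlim : Tendsto (fun n : ℕ => 16 * C * ‖v‖ ^ 2 / R ^ 2 * (ε / ((n : ℝ) + 1))) atTop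
        (𝓝 (16 * C * ‖v‖ ^ 2 / R ^ 2 * 0)) := by
      refine Tendsto.const_mul _ ?_
      simpa [div_eq_mul_inv] using (tendsto_one_div_add_atTop_nhds_zero_nat (𝕜 := ℝ)).const_mul ε
    rw [mul_zero] at hlim
    filter_upwards [hlim.eventually_lt_const hη] with n hn z hz
    refine lt_of_le_of_lt ?_ hn
    have hsub : ball z (R / 2) ⊆ ball c R := ball_subset_ball' (by linarith [mem_ball.mp hz])
    have key := norm_sub_sub_fderiv_le_of_norm_le_on_ball (f := f) (c := z) (z := z + t n • v)
      (R := R / 2) (C := C) (hfR.mono hsub) (fun w hw => (hRs w (hsub hw)).2)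
      (by rw [mem_ball, dist_eq_norm, add_sub_cancel_left]; exact htv n)
    rw [add_sub_cancel_left, map_smul] at key
    rw [dist_comm, dist_eq_norm]
    calc ‖(t n)⁻¹ • (f (z + t n • v) - f z) - fderiv ℂ f z v‖
        = ‖(t n)⁻¹ • (f (z + t n • v) - f z - t n • fderiv ℂ f z v)‖ := by
          rw [smul_sub _ (_ - _), inv_smul_smul₀ (ht0 n)]
      _ ≤ ‖t n‖⁻¹ * (4 * C * (‖t n • v‖ / (R / 2)) ^ 2) := by
          rw [norm_smul, norm_inv]
          gcongr
      _ = 16 * C * ‖v‖ ^ 2 / R ^ 2 * (ε / (n + 1)) := by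
          have h0 : ‖t n‖ ≠ 0 := norm_ne_zero_iff.mpr (ht0 n)
          rw [norm_smul, ← htn]
          field_simp
          ring

/-- A holomorphic map on an open subset of a finite-dimensional space is smooth. -/
theorem DifferentiableOn.contDiffOn_of_finiteDimensional [CompleteSpace F] [FiniteDimensional ℂ E]
    {f : E → F} {s : Set E} (hf : DifferentiableOn ℂ f s) (hs : IsOpen s) :
    ContDiffOn ℂ ∞ f s := by
  rw [contDiffOn_infty]
  intro n
  induction n generalizing f with
  | zero => simpa using hf.continuousOn
  | succ n ih =>
    rw [Nat.cast_succ, contDiffOn_succ_iff_fderiv_of_isOpen hs]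
    refine ⟨hf, by simp, ?_⟩
    -- Finite dimension enters here: smoothness of `fderiv ℂ f` reduces to that of each directional
    -- derivative, which is again holomorphic.
    rw [contDiffOn_clm_apply]
    exact fun v => ih (hf.fderiv_apply_of_isOpen hs v)

end SeveralComplexVariables

/-! ### Mean value inequality on polydiscs and the local `L²` to sup bound. -/

section MeanValue

open Metric Real
open scoped ENNReal

variable {n : ℕ}

/-- Multiplication by a complex number of modulus one preserves Lebesgue measure on `ℂⁿ`. -/
theorem measurePreserving_circle_smul (c : Circle) :
    MeasurePreserving (fun v : Fin n → ℂ => (c : ℂ) • v) volume volume := by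
  have := volume_preserving_pi (ι := Fin n) (f := fun _ => (rotation c : ℂ → ℂ))
    fun _ => (rotation c).measurePreserving
  exact this

theorem setLIntegral_ball_comp_add_circle_smul (c : Circle) (z : Fin n → ℂ) (R : ℝ)
    (g : (Fin n → ℂ) → ℝ≥0∞) :
    ∫⁻ v in ball (0 : Fin n → ℂ) R, g (z + (c : ℂ) • v) = ∫⁻ w in ball z R, g w := by
  have h2 := (measurePreserving_add_left (volume : Measure (Fin n → ℂ)) z)
    |>.setLIntegral_comp_preimage_emb (measurableEmbedding_addLeft z) g (ball z R)
  have h1 := (measurePreserving_circle_smul (n := n) c).setLIntegral_comp_preimage_emb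
    (Homeomorph.smulOfNeZero (c : ℂ) c.coe_ne_zero).measurableEmbedding
    (fun v => g (z + v)) (ball 0 R)
  rw [← h2]
  have e1 : (fun v : Fin n → ℂ => z + v) ⁻¹' ball z R = ball 0 R := by
    ext v; simp [dist_eq_norm]
  have e2 : (fun v : Fin n → ℂ => (c : ℂ) • v) ⁻¹' ball 0 R = ball 0 R := by
    ext v; simp [norm_smul, Circle.norm_coe]
  rw [e2] at h1
  rw [e1, ← h1]

/-- The one-variable mean value property on the disc `t ↦ z + t • v`, `|t| ≤ 1`. -/
theorem two_pi_mul_enorm_le_lintegral_circle {f : (Fin n → ℂ) → ℂ} {z v : Fin n → ℂ} {R : ℝ}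
    (hd : DifferentiableOn ℂ f (ball z R)) (hv : v ∈ ball (0 : Fin n → ℂ) R) :
    ENNReal.ofReal (2 * π) * ‖f z‖ₑ ≤
      ∫⁻ θ in Set.Ioc 0 (2 * π), ‖f (z + (Circle.exp θ : ℂ) • v)‖ₑ := by
  have hmem : ∀ t ∈ closedBall (0 : ℂ) 1, z + t • v ∈ ball z R := by
    intro t ht
    simp only [mem_closedBall, dist_zero_right, mem_ball] at ht hv ⊢
    rw [dist_eq_norm, add_sub_cancel_left, norm_smul]
    nlinarith [norm_nonneg v]
  have hg : DifferentiableOn ℂ (fun t : ℂ => f (z + t • v)) (closedBall (0 : ℂ) 1) :=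
    hd.comp (by fun_prop) hmem
  have hcl : DiffContOnCl ℂ (fun t : ℂ => f (z + t • v)) (ball (0 : ℂ) |1|) := by
    rw [abs_one]
    exact DiffContOnCl.mk (hg.mono ball_subset_closedBall)
      (by rw [closure_ball _ one_ne_zero]; exact hg.continuousOn)
  have h := hcl.circleAverage
  rw [Real.circleAverage_def, zero_smul, add_zero,
    intervalIntegral.integral_of_le (by positivity)] at h
  have hpi : (0 : ℝ) < 2 * π := by positivity
  have h' : ((2 * π : ℝ)) • f z =
      ∫ θ in Set.Ioc 0 (2 * π), f (z + (Circle.exp θ : ℂ) • v) := by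
    rw [← h, smul_inv_smul₀ hpi.ne']
    simp [circleMap, Circle.coe_exp]
  calc ENNReal.ofReal (2 * π) * ‖f z‖ₑ = ‖((2 * π : ℝ)) • f z‖ₑ := by
        rw [enorm_smul, Real.enorm_eq_ofReal hpi.le]
    _ ≤ _ := by rw [h']; exact enorm_integral_le_lintegral_enorm _

/-- The mean value inequality for holomorphic functions on a polydisc. -/
theorem volume_ball_mul_enorm_le {f : (Fin n → ℂ) → ℂ} {z : Fin n → ℂ} {R : ℝ}
    (hd : DifferentiableOn ℂ f (ball z R)) :
    volume (ball z R) * ‖f z‖ₑ ≤ ∫⁻ w in ball z R, ‖f w‖ₑ := by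
  have hpi : (0 : ℝ) < 2 * π := by positivity
  have hpi' : ENNReal.ofReal (2 * π) ≠ 0 := by simpa using hpi
  refine (ENNReal.mul_le_mul_iff_right hpi' ENNReal.ofReal_ne_top).mp ?_
  -- Integrate the circle inequality over all `v` and exchange the integrals: the polydisc and
  -- Lebesgue measure are invariant under `v ↦ e^{iθ} v`, so the inner integral does not depend on
  -- `θ`.
  have hswap := lintegral_lintegral_swap (μ := volume.restrict (ball (0 : Fin n → ℂ) R))
    (ν := volume.restrict (Set.Ioc 0 (2 * π)))
    (f := fun v θ => ‖f (z + (Circle.exp θ : ℂ) • v)‖ₑ) (by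
      rw [Measure.prod_restrict]
      refine ContinuousOn.aemeasurable ?_ (measurableSet_ball.prod measurableSet_Ioc)
      refine ContinuousOn.enorm (hd.continuousOn.comp (by fun_prop) ?_)
      rintro ⟨v, θ⟩ ⟨hv, -⟩
      rw [mem_ball, dist_eq_norm, add_sub_cancel_left, norm_smul, Circle.norm_coe, one_mul]
      simpa using hv)
  calc ENNReal.ofReal (2 * π) * (volume (ball z R) * ‖f z‖ₑ)
      = ∫⁻ _ in ball (0 : Fin n → ℂ) R, ENNReal.ofReal (2 * π) * ‖f z‖ₑ := by
        rw [setLIntegral_const]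
        have : volume (ball z R) = volume (ball (0 : Fin n → ℂ) R) := by
          rw [Measure.addHaar_ball_center]
        rw [this]; ring
    _ ≤ ∫⁻ v in ball (0 : Fin n → ℂ) R, ∫⁻ θ in Set.Ioc 0 (2 * π),
          ‖f (z + (Circle.exp θ : ℂ) • v)‖ₑ :=
        setLIntegral_mono' measurableSet_ball fun v hv =>
          two_pi_mul_enorm_le_lintegral_circle hd hv
    _ = ∫⁻ _ in Set.Ioc 0 (2 * π), ∫⁻ w in ball z R, ‖f w‖ₑ := by
        rw [hswap]
        refine lintegral_congr fun θ => ?_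
        exact setLIntegral_ball_comp_add_circle_smul (Circle.exp θ) z R fun w => ‖f w‖ₑ
    _ = _ := by
        rw [setLIntegral_const, Real.volume_Ioc, sub_zero, mul_comm]

/-- The mean value inequality for the squared modulus of a holomorphic function. -/
theorem volume_ball_mul_enorm_sq_le {f : (Fin n → ℂ) → ℂ} {z : Fin n → ℂ} {R : ℝ}
    (hd : DifferentiableOn ℂ f (ball z R)) :
    volume (ball z R) * ‖f z‖ₑ ^ 2 ≤ ∫⁻ w in ball z R, ‖f w‖ₑ ^ 2 := by
  simpa [enorm_pow] using volume_ball_mul_enorm_le (hd.pow 2)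

/-- A holomorphic function on a polydisc is bounded on the half polydisc by its `L²` norm. -/
theorem exists_norm_le_mul_of_setLIntegral_le (n : ℕ) {R : ℝ} (hR : 0 < R) :
    ∃ C : ℝ, 0 < C ∧ ∀ (f : (Fin n → ℂ) → ℂ) (z : Fin n → ℂ) (M : ℝ),
      DifferentiableOn ℂ f (ball z R) → 0 ≤ M →
      ∫⁻ w in ball z R, ‖f w‖ₑ ^ 2 ≤ ENNReal.ofReal (M ^ 2) →
      ∀ w ∈ ball z (R / 2), ‖f w‖ ≤ C * M := by
  have hV0 : 0 < volume (ball (0 : Fin n → ℂ) (R / 2)) := measure_ball_pos _ _ (by positivity)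
  have hVt : volume (ball (0 : Fin n → ℂ) (R / 2)) ≠ ⊤ := measure_ball_lt_top.ne
  set V := (volume (ball (0 : Fin n → ℂ) (R / 2))).toReal with hV
  have hVpos : 0 < V := ENNReal.toReal_pos hV0.ne' hVt
  refine ⟨(√V)⁻¹, by positivity, fun f z M hd hM hint w hw => ?_⟩
  have hsub : ball w (R / 2) ⊆ ball z R := ball_subset_ball' (by linarith [mem_ball.mp hw])
  have h1 := (volume_ball_mul_enorm_sq_le (hd.mono hsub)).trans
    ((lintegral_mono_set hsub).trans hint)
  rw [Measure.addHaar_ball_center, ← ENNReal.ofReal_toReal hVt, ← hV, ← ofReal_norm,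
    ← ENNReal.ofReal_pow (norm_nonneg _), ← ENNReal.ofReal_mul hVpos.le,
    ENNReal.ofReal_le_ofReal_iff (by positivity)] at h1
  rw [inv_mul_eq_div, le_div_iff₀ (by positivity)]
  refine abs_le_of_sq_le_sq' ?_ hM |>.2
  rw [mul_pow, Real.sq_sqrt hVpos.le]
  linarith

end MeanValue

/-! ### The Bergman space: representatives, point evaluations, completeness. -/

section Bergman

open Metric Filter Topology
open scoped ENNReal

variable {n : ℕ} {Ω : Set (Fin n → ℂ)}

theorem bergmanSpace.differentiableOn_toFun (f : bergmanSpace Ω) :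
    DifferentiableOn ℂ (bergmanSpace.toFun f) Ω :=
  (Classical.choose_spec f.2).1

theorem bergmanSpace.coeFn_ae_eq_toFun (f : bergmanSpace Ω) :
    (f : Lp ℂ 2 (volume.restrict Ω)) =ᵐ[volume.restrict Ω] bergmanSpace.toFun f :=
  (Classical.choose_spec f.2).2

/-- Continuous functions that agree almost everywhere on an open set agree there, so the
representative chosen in `bergmanSpace.toFun` can be replaced by any holomorphic one. -/
theorem bergmanSpace.eqOn_toFun (hΩ : IsOpen Ω) {f : bergmanSpace Ω} {F : (Fin n → ℂ) → ℂ}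
    (hF : DifferentiableOn ℂ F Ω)
    (hfF : (f : Lp ℂ 2 (volume.restrict Ω)) =ᵐ[volume.restrict Ω] F) :
    Set.EqOn (bergmanSpace.toFun f) F Ω :=
  Measure.eqOn_open_of_ae_eq ((coeFn_ae_eq_toFun f).symm.trans hfF) hΩ
    (differentiableOn_toFun f).continuousOn hF.continuousOn

theorem bergmanSpace.eqOn_toFun_add (hΩ : IsOpen Ω) (f g : bergmanSpace Ω) :
    Set.EqOn (bergmanSpace.toFun (f + g)) (bergmanSpace.toFun f + bergmanSpace.toFun g) Ω :=
  eqOn_toFun hΩ ((differentiableOn_toFun f).add (differentiableOn_toFun g))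
    ((Lp.coeFn_add _ _).trans ((coeFn_ae_eq_toFun f).add (coeFn_ae_eq_toFun g)))

theorem bergmanSpace.eqOn_toFun_smul (hΩ : IsOpen Ω) (c : ℂ) (f : bergmanSpace Ω) :
    Set.EqOn (bergmanSpace.toFun (c • f)) (c • bergmanSpace.toFun f) Ω :=
  eqOn_toFun hΩ ((differentiableOn_toFun f).const_smul c)
    ((Lp.coeFn_smul _ _).trans ((coeFn_ae_eq_toFun f).const_smul c))

theorem enorm_sq_eq_lintegral {α : Type*} [MeasurableSpace α] {μ : Measure α} {f : Lp ℂ 2 μ}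
    {F : α → ℂ} (hf : f =ᵐ[μ] F) : ENNReal.ofReal (‖f‖ ^ 2) = ∫⁻ x, ‖F x‖ₑ ^ 2 ∂μ := by
  have h : ∫⁻ x, ‖f x‖ₑ ^ 2 ∂μ = ∫⁻ x, ‖F x‖ₑ ^ 2 ∂μ :=
    lintegral_congr_ae (hf.fun_comp fun z => ‖z‖ₑ ^ 2)
  rw [← h, Lp.norm_def,
    ENNReal.ofReal_pow ENNReal.toReal_nonneg, ENNReal.ofReal_toReal (Lp.eLpNorm_ne_top f),
    eLpNorm_eq_lintegral_rpow_enorm_toReal two_ne_zero ENNReal.ofNat_ne_top]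
  rw [← ENNReal.rpow_natCast, ← ENNReal.rpow_mul]
  simp

theorem bergmanSpace.lintegral_toFun (f : bergmanSpace Ω) :
    ∫⁻ w in Ω, ‖bergmanSpace.toFun f w‖ₑ ^ 2 = ENNReal.ofReal (‖f‖ ^ 2) :=
  (enorm_sq_eq_lintegral (coeFn_ae_eq_toFun f)).symm

/-- A holomorphic function with bounded `L²` norm represents an element of the Bergman space. -/
theorem exists_bergmanSpace_toFun_eqOn (hΩ : IsOpen Ω) {F : (Fin n → ℂ) → ℂ}
    (hF : DifferentiableOn ℂ F Ω) {M : ℝ} (hM : 0 ≤ M)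
    (hint : ∫⁻ w in Ω, ‖F w‖ₑ ^ 2 ≤ ENNReal.ofReal (M ^ 2)) :
    ∃ f : bergmanSpace Ω, ‖f‖ ≤ M ∧ Set.EqOn (bergmanSpace.toFun f) F Ω := by
  have hmem : MemLp F 2 (volume.restrict Ω) := by
    refine ⟨hF.continuousOn.aestronglyMeasurable hΩ.measurableSet, ?_⟩
    rw [eLpNorm_lt_top_iff_lintegral_rpow_enorm_lt_top two_ne_zero ENNReal.ofNat_ne_top]
    refine lt_of_le_of_lt ?_ (ENNReal.ofReal_lt_top (r := M ^ 2))
    simpa using hint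
  refine ⟨⟨hmem.toLp F, F, hF, hmem.coeFn_toLp⟩, ?_,
    bergmanSpace.eqOn_toFun hΩ hF hmem.coeFn_toLp⟩
  have := enorm_sq_eq_lintegral (hmem.coeFn_toLp)
  rw [← this, ENNReal.ofReal_le_ofReal_iff (by positivity)] at hint
  exact abs_le_of_sq_le_sq' hint hM |>.2

/-- Point evaluations on the Bergman space are locally uniformly bounded. -/
theorem bergmanSpace.exists_norm_toFun_le {z : Fin n → ℂ} {R : ℝ} (hR : 0 < R)
    (hsub : ball z R ⊆ Ω) :
    ∃ C : ℝ, 0 < C ∧ ∀ f : bergmanSpace Ω, ∀ w ∈ ball z (R / 2),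
      ‖bergmanSpace.toFun f w‖ ≤ C * ‖f‖ := by
  obtain ⟨C, hC, h⟩ := exists_norm_le_mul_of_setLIntegral_le n hR
  exact ⟨C, hC, fun f => h _ z ‖f‖ ((differentiableOn_toFun f).mono hsub) (norm_nonneg _)
    ((lintegral_mono_set hsub).trans (lintegral_toFun f).le)⟩

theorem bergmanSpace.toFun_sub (hΩ : IsOpen Ω) (f g : bergmanSpace Ω) {z : Fin n → ℂ}
    (hz : z ∈ Ω) :
    bergmanSpace.toFun (f - g) z = bergmanSpace.toFun f z - bergmanSpace.toFun g z := by
  have h := eqOn_toFun_add hΩ (f - g) g hz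
  rw [sub_add_cancel, Pi.add_apply] at h
  rw [h, add_sub_cancel_right]

/-- The Bergman space of an open set is a closed subspace of `L²`. -/
theorem isClosed_bergmanSpace (hΩ : IsOpen Ω) :
    IsClosed (bergmanSpace Ω : Set (Lp ℂ 2 ((volume : Measure (Fin n → ℂ)).restrict Ω))) := by
  apply IsSeqClosed.isClosed
  intro f g hf hfg
  let φ : ℕ → bergmanSpace Ω := fun k => ⟨f k, hf k⟩
  have hφ : CauchySeq φ := by
    have h := Metric.cauchySeq_iff.mp hfg.cauchySeq
    exact Metric.cauchySeq_iff.mpr h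
  -- Bounded point evaluations upgrade `L²` Cauchy to locally uniformly Cauchy, so the pointwise
  -- limit is holomorphic.
  have hunif : ∀ z ∈ Ω, ∃ r > 0, ball z r ⊆ Ω ∧
      UniformCauchySeqOn (fun k => bergmanSpace.toFun (φ k)) atTop (ball z r) := by
    intro z hz
    obtain ⟨R, hR, hsub⟩ := Metric.isOpen_iff.mp hΩ z hz
    obtain ⟨C, hC, hb⟩ := bergmanSpace.exists_norm_toFun_le hR hsub
    have hsub' : ball z (R / 2) ⊆ Ω := (ball_subset_ball (by linarith)).trans hsub
    refine ⟨R / 2, by positivity, hsub', ?_⟩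
    rw [Metric.uniformCauchySeqOn_iff]
    intro ε hε
    obtain ⟨N, hN⟩ := Metric.cauchySeq_iff.mp hφ (ε / C) (by positivity)
    refine ⟨N, fun a ha b hb' w hw => ?_⟩
    have h1 := hN a ha b hb'
    rw [dist_eq_norm] at h1 ⊢
    rw [← bergmanSpace.toFun_sub hΩ _ _ (hsub' hw)]
    refine (hb _ w hw).trans_lt ?_
    rwa [lt_div_iff₀ hC, mul_comm] at h1
  have hlim : ∀ z ∈ Ω, ∃ L, Tendsto (fun k => bergmanSpace.toFun (φ k) z) atTop (𝓝 L) := by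
    intro z hz
    obtain ⟨r, hr, -, h⟩ := hunif z hz
    exact cauchy_map_iff_exists_tendsto.mp (h.cauchy_map (mem_ball_self hr))
  choose! G hG using hlim
  refine ⟨G, fun z hz => ?_, ?_⟩
  · obtain ⟨r, hr, hsub, h⟩ := hunif z hz
    exact (differentiableAt_of_tendstoUniformlyOn_ball hr
      (fun k => (bergmanSpace.differentiableOn_toFun (φ k)).mono hsub)
      (h.tendstoUniformlyOn_of_tendsto fun w hw => hG w (hsub hw))).differentiableWithinAt
  -- An almost everywhere convergent subsequence identifies the `L²` limit with the pointwise limit.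
  · obtain ⟨ns, hns, hae⟩ := (tendstoInMeasure_of_tendsto_Lp hfg).exists_seq_tendsto_ae
    have hall : ∀ᵐ w ∂(volume.restrict Ω), ∀ k, f k w = bergmanSpace.toFun (φ k) w :=
      ae_all_iff.mpr fun k => bergmanSpace.coeFn_ae_eq_toFun (φ k)
    filter_upwards [hae, hall, ae_restrict_mem hΩ.measurableSet] with w hw hk hwΩ
    refine tendsto_nhds_unique hw ?_
    simp_rw [hk]
    exact (hG w hwΩ).comp hns.tendsto_atTop

theorem completeSpace_bergmanSpace (hΩ : IsOpen Ω) : CompleteSpace (bergmanSpace Ω) :=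
  (isClosed_bergmanSpace hΩ).completeSpace_coe

end Bergman

/-! ### The evaluation map into a Hilbert space and its relation to the kernel. -/

section HilbertMap

open Metric Filter Topology
open scoped ENNReal InnerProductSpace lp

variable {n : ℕ} {Ω : Set (Fin n → ℂ)}

/-- Evaluation at points of `Ω` as continuous functionals on the Bergman space. -/
theorem bergmanSpace.exists_eval (hΩ : IsOpen Ω) :
    ∃ L : (Fin n → ℂ) → StrongDual ℂ (bergmanSpace Ω),
      ∀ z ∈ Ω, ∀ f, L z f = bergmanSpace.toFun f z := by
  suffices h : ∀ z ∈ Ω, ∃ L : StrongDual ℂ (bergmanSpace Ω), ∀ f, L f = bergmanSpace.toFun f z by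
    choose! L hL using h
    exact ⟨L, hL⟩
  intro z hz
  obtain ⟨R, hR, hsub⟩ := Metric.isOpen_iff.mp hΩ z hz
  obtain ⟨C, hC, hb⟩ := bergmanSpace.exists_norm_toFun_le hR hsub
  exact ⟨LinearMap.mkContinuous
    { toFun := fun f => bergmanSpace.toFun f z
      map_add' := fun f g => eqOn_toFun_add hΩ f g hz
      map_smul' := fun c f => eqOn_toFun_smul hΩ c f hz } C
    fun f => hb f z (mem_ball_self (by positivity)), fun f => rfl⟩

/-- A locally bounded weak-* holomorphic map to a dual space is holomorphic. -/
theorem differentiableAt_strongDual_of_norm_le {E H : Type*} [NormedAddCommGroup E]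
    [NormedSpace ℂ E] [NormedAddCommGroup H] [NormedSpace ℂ H] {L : E → StrongDual ℂ H} {z : E}
    {R C : ℝ} (hR : 0 < R) (hd : ∀ f, DifferentiableOn ℂ (fun w => L w f) (ball z R))
    (hb : ∀ w ∈ ball z R, ‖L w‖ ≤ C) : DifferentiableAt ℂ L z := by
  have hC : 0 ≤ C := (norm_nonneg _).trans (hb z (mem_ball_self hR))
  have hb' : ∀ f, ∀ w ∈ ball z R, ‖L w f‖ ≤ C * ‖f‖ := fun f w hw =>
    ((L w).le_opNorm f).trans (by gcongr; exact hb w hw)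
  have hdz : ∀ f, DifferentiableAt ℂ (fun w => L w f) z := fun f =>
    (hd f).differentiableAt (ball_mem_nhds z hR)
  -- The candidate derivative is assembled from the derivatives of the scalar functions `w ↦ L w f`.
  -- Cauchy and Taylor bounds are linear in `‖f‖`, hence hold in the dual norm.
  let B : E →ₗ[ℂ] H →ₗ[ℂ] ℂ := LinearMap.mk₂ ℂ
    (fun v f => fderiv ℂ (fun w => L w f) z v)
    (fun v w f => map_add _ v w) (fun c v f => map_smul _ c v)
    (fun v f g => by
      simp only [map_add]
      rw [fderiv_fun_add (hdz f) (hdz g), add_apply])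
    (fun c v f => by
      simp only [map_smul]
      rw [fderiv_fun_const_smul (hdz f), smul_apply])
  have hB : ∀ v f, ‖B v f‖ ≤ 2 * C / R * ‖v‖ * ‖f‖ := by
    intro v f
    refine (ContinuousLinearMap.le_opNorm _ _).trans ?_
    have := norm_fderiv_le_of_norm_le_on_ball (hd f) (hb' f) hR
    calc _ ≤ 2 * (C * ‖f‖) / R * ‖v‖ := by gcongr
      _ = _ := by ring
  let B' : E →L[ℂ] StrongDual ℂ H := B.mkContinuous₂ _ hB
  have hO : (fun w => L w - L z - B' (w - z)) =O[𝓝 z] fun w => ‖w - z‖ ^ 2 := by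
    refine Asymptotics.IsBigO.of_bound (4 * C / R ^ 2) ?_
    filter_upwards [ball_mem_nhds z hR] with w hw
    rw [norm_pow, norm_norm]
    refine ContinuousLinearMap.opNorm_le_bound _ (by positivity) fun f => ?_
    have key := norm_sub_sub_fderiv_le_of_norm_le_on_ball (hd f) (hb' f) hw
    rw [sub_apply, sub_apply]
    refine key.trans (le_of_eq ?_)
    rw [div_pow]
    ring
  have h : HasFDerivAt L B' z := .of_isLittleO
    (hO.trans_isLittleO (Asymptotics.isLittleO_pow_sub_sub z one_lt_two))
  exact h.differentiableAt

/-- Evaluation depends holomorphically on the point, in the norm of the dual of the Bergman space. -/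
theorem bergmanSpace.differentiableOn_eval (hΩ : IsOpen Ω)
    {L : (Fin n → ℂ) → StrongDual ℂ (bergmanSpace Ω)}
    (hL : ∀ z ∈ Ω, ∀ f, L z f = bergmanSpace.toFun f z) : DifferentiableOn ℂ L Ω := by
  intro z hz
  obtain ⟨R, hR, hsub⟩ := Metric.isOpen_iff.mp hΩ z hz
  obtain ⟨C, hC, hb⟩ := bergmanSpace.exists_norm_toFun_le hR hsub
  have hsub' : ball z (R / 2) ⊆ Ω := (ball_subset_ball (by linarith)).trans hsub
  refine (differentiableAt_strongDual_of_norm_le (R := R / 2) (C := C) (by positivity)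
    (fun f => ?_) fun w hw => ?_).differentiableWithinAt
  · exact ((differentiableOn_toFun f).mono hsub').congr fun w hw => hL w (hsub' hw) f
  · refine ContinuousLinearMap.opNorm_le_bound _ hC.le fun f => ?_
    rw [hL w (hsub' hw)]
    exact hb f w hw

/-- The `ℓ²` sequence `j ↦ ℓ (e_j)` of a functional `ℓ`, where `(e_j)` is a Hilbert basis. -/
noncomputable def HilbertBasis.dualRepr {ι H : Type*} [NormedAddCommGroup H]
    [InnerProductSpace ℂ H] [CompleteSpace H] (b : HilbertBasis ι ℂ H) :
    StrongDual ℂ H →L[ℂ] ℓ²(ι, ℂ) :=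
  LinearMap.mkContinuous
    -- The Riesz isomorphism is conjugate linear; conjugating the coordinates restores complex
    -- linearity, so that composition with evaluation stays holomorphic.
    { toFun := fun l => star (b.repr ((InnerProductSpace.toDual ℂ H).symm l))
      map_add' := fun l m => by simp
      map_smul' := fun c l => by
        rw [LinearIsometryEquiv.map_smulₛₗ, map_smul]
        ext i
        simp } 1
    fun l => by
      change ‖star (b.repr ((InnerProductSpace.toDual ℂ H).symm l))‖ ≤ _
      simp [norm_star]

theorem HilbertBasis.dualRepr_apply {ι H : Type*} [NormedAddCommGroup H]
    [InnerProductSpace ℂ H] [CompleteSpace H] (b : HilbertBasis ι ℂ H) (l : StrongDual ℂ H)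
    (i : ι) : b.dualRepr l i = l (b i) := by
  change star (b.repr ((InnerProductSpace.toDual ℂ H).symm l)) i = _
  rw [lp.star_apply, HilbertBasis.repr_apply_apply, RCLike.star_def, inner_conj_symm,
    InnerProductSpace.toDual_symm_apply]

theorem HilbertBasis.inner_dualRepr {ι H : Type*} [NormedAddCommGroup H]
    [InnerProductSpace ℂ H] [CompleteSpace H] (b : HilbertBasis ι ℂ H) (u : ℓ²(ι, ℂ))
    (l : StrongDual ℂ H) : ⟪u, b.dualRepr l⟫_ℂ = l (b.repr.symm (star u)) := by
  rw [← InnerProductSpace.toDual_symm_apply, ← b.repr.inner_map_map,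
    LinearIsometryEquiv.apply_symm_apply, lp.inner_eq_tsum, lp.inner_eq_tsum]
  refine tsum_congr fun i => ?_
  rw [dualRepr_apply, lp.star_apply, HilbertBasis.repr_apply_apply]
  rw [← InnerProductSpace.toDual_symm_apply, RCLike.inner_apply, RCLike.inner_apply,
    inner_conj_symm, mul_comm]
  rfl

/-- In a complete space a maximal orthonormal set has trivial orthogonal complement, hence is a
Hilbert basis. -/
theorem exists_hilbertBasis_eq_bergmanBasis (hΩ : IsOpen Ω) :
    ∃ b : HilbertBasis (bergmanBasis Ω) ℂ (bergmanSpace Ω), ∀ e, b e = e.1 := by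
  have := completeSpace_bergmanSpace hΩ
  have ⟨ho, hmax⟩ := bergmanBasis_spec Ω
  have hbot := (maximal_orthonormal_iff_orthogonalComplement_eq_bot ho).mp hmax
  exact ⟨HilbertBasis.mkOfOrthogonalEqBot ho (by rwa [Subtype.range_coe]), fun e => by
    rw [HilbertBasis.coe_mkOfOrthogonalEqBot]⟩

theorem bergmanKernel_eq_inner_dualRepr {L : (Fin n → ℂ) → StrongDual ℂ (bergmanSpace Ω)}
    (hL : ∀ z ∈ Ω, ∀ f, L z f = bergmanSpace.toFun f z) [CompleteSpace (bergmanSpace Ω)]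
    {b : HilbertBasis (bergmanBasis Ω) ℂ (bergmanSpace Ω)} (hb : ∀ e, b e = e.1) {z : Fin n → ℂ}
    (hz : z ∈ Ω) : bergmanKernel Ω z z = ⟪b.dualRepr (L z), b.dualRepr (L z)⟫_ℂ := by
  rw [lp.inner_eq_tsum, bergmanKernel]
  refine tsum_congr fun e => ?_
  rw [b.dualRepr_apply, hL z hz, hb]
  rfl

/-- The Bergman space realized through a holomorphic map to a Hilbert space: the kernel is the
squared norm of the map, and the functions of the Bergman space are its inner products with
constant vectors. -/
theorem exists_bergman_map (hΩ : IsOpen Ω) :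
    ∃ Φ : (Fin n → ℂ) → ℓ²(bergmanBasis Ω, ℂ), DifferentiableOn ℂ Φ Ω ∧
      (∀ z ∈ Ω, bergmanKernel Ω z z = ⟪Φ z, Φ z⟫_ℂ) ∧
      (∀ u : ℓ²(bergmanBasis Ω, ℂ), ∃ f : bergmanSpace Ω, ‖f‖ = ‖u‖ ∧
        ∀ z ∈ Ω, ⟪u, Φ z⟫_ℂ = bergmanSpace.toFun f z) ∧
      (∀ f : bergmanSpace Ω, ∃ u : ℓ²(bergmanBasis Ω, ℂ), ‖u‖ = ‖f‖ ∧
        ∀ z ∈ Ω, ⟪u, Φ z⟫_ℂ = bergmanSpace.toFun f z) := by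
  have := completeSpace_bergmanSpace hΩ
  refine (bergmanSpace.exists_eval hΩ).elim fun L hL => ?_
  refine (exists_hilbertBasis_eq_bergmanBasis hΩ).elim fun b hb => ?_
  have hinner : ∀ u, ∀ z ∈ Ω, ⟪u, b.dualRepr (L z)⟫_ℂ =
      bergmanSpace.toFun (b.repr.symm (star u)) z := fun u z hz => by
    rw [b.inner_dualRepr, hL z hz]
  refine ⟨fun z => b.dualRepr (L z),
    b.dualRepr.differentiable.comp_differentiableOn (bergmanSpace.differentiableOn_eval hΩ hL),
    fun z hz => bergmanKernel_eq_inner_dualRepr hL hb hz, fun u => ?_, fun f => ?_⟩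
  · exact ⟨b.repr.symm (star u), by rw [LinearIsometryEquiv.norm_map, norm_star], hinner u⟩
  · refine ⟨star (b.repr f), by rw [norm_star, LinearIsometryEquiv.norm_map], fun z hz => ?_⟩
    rw [hinner _ z hz, star_star, LinearIsometryEquiv.symm_apply_apply]

end HilbertMap

/-! ### Calculus of Wirtinger derivatives. -/

section Wirtinger

open Filter Topology
open scoped InnerProductSpace

variable {n : ℕ} {i j k l : Fin n} {F G : (Fin n → ℂ) → ℂ} {a b c d : ℂ} {z : Fin n → ℂ}

/-- `F` is real differentiable at `z` with Wirtinger derivatives `∂F/∂zᵢ = a`, `∂F/∂z̄ᵢ = b`. -/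
structure HasWirtingerAt (i : Fin n) (F : (Fin n → ℂ) → ℂ) (a b : ℂ) (z : Fin n → ℂ) : Prop where
  differentiableAt : DifferentiableAt ℝ F z
  wirtinger_eq : wirtinger i F z = a
  wirtingerBar_eq : wirtingerBar i F z = b

namespace HasWirtingerAt

theorem sub (hF : HasWirtingerAt i F a b z) (hG : HasWirtingerAt i G c d z) :
    HasWirtingerAt i (fun w => F w - G w) (a - c) (b - d) z := by
  refine ⟨hF.1.sub hG.1, ?_, ?_⟩
  · rw [← hF.2, ← hG.2]
    simp only [wirtinger, fderiv_fun_sub hF.1 hG.1, sub_apply]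
    ring
  · rw [← hF.3, ← hG.3]
    simp only [wirtingerBar, fderiv_fun_sub hF.1 hG.1, sub_apply]
    ring

theorem mul (hF : HasWirtingerAt i F a b z) (hG : HasWirtingerAt i G c d z) :
    HasWirtingerAt i (fun w => F w * G w) (a * G z + F z * c) (b * G z + F z * d) z := by
  refine ⟨hF.1.mul hG.1, ?_, ?_⟩
  · rw [← hF.2, ← hG.2]
    simp only [wirtinger, fderiv_fun_mul hF.1 hG.1, add_apply, smul_apply, smul_eq_mul]
    ring
  · rw [← hF.3, ← hG.3]
    simp only [wirtingerBar, fderiv_fun_mul hF.1 hG.1, add_apply, smul_apply, smul_eq_mul]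
    ring

theorem inv (hF : HasWirtingerAt i F a b z) (h0 : F z ≠ 0) :
    HasWirtingerAt i (fun w => (F w)⁻¹) (-a / F z ^ 2) (-b / F z ^ 2) z := by
  have hd : HasFDerivAt (fun w => (F w)⁻¹) ((-(F z ^ 2)⁻¹ : ℂ) • fderiv ℝ F z) z := by
    have := (((hasDerivAt_inv h0).hasFDerivAt.restrictScalars ℝ).comp z hF.1.hasFDerivAt)
    refine this.congr_fderiv ?_
    ext v
    simp [mul_comm]
  refine ⟨hd.differentiableAt, ?_, ?_⟩
  · rw [← hF.2]
    simp only [wirtinger, hd.fderiv, smul_apply, smul_eq_mul]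
    field_simp
    ring
  · rw [← hF.3]
    simp only [wirtingerBar, hd.fderiv, smul_apply, smul_eq_mul]
    field_simp
    ring

theorem clog (hF : HasWirtingerAt i F a b z) (h0 : F z ∈ Complex.slitPlane) :
    HasWirtingerAt i (fun w => Complex.log (F w)) (a / F z) (b / F z) z := by
  have hd : HasFDerivAt (fun w => Complex.log (F w)) ((F z)⁻¹ • fderiv ℝ F z) z := by
    have := (((Complex.hasDerivAt_log h0).hasFDerivAt.restrictScalars ℝ).comp z hF.1.hasFDerivAt)
    refine this.congr_fderiv ?_
    ext v
    simp [mul_comm]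
  refine ⟨hd.differentiableAt, ?_, ?_⟩
  · rw [← hF.2]
    simp only [wirtinger, hd.fderiv, smul_apply, smul_eq_mul]
    ring
  · rw [← hF.3]
    simp only [wirtingerBar, hd.fderiv, smul_apply, smul_eq_mul]
    ring

/-- The inner product is conjugate linear on the left: `∂` sees only the holomorphic right argument
and `∂̄` only the left one. -/
theorem inner {H : Type*} [NormedAddCommGroup H] [InnerProductSpace ℂ H]
    {f g : (Fin n → ℂ) → H} (hf : DifferentiableAt ℂ f z) (hg : DifferentiableAt ℂ g z)
    (i : Fin n) :
    HasWirtingerAt i (fun w => ⟪g w, f w⟫_ℂ) ⟪g z, fderiv ℂ f z (Pi.single i 1)⟫_ℂ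
      ⟪fderiv ℂ g z (Pi.single i 1), f z⟫_ℂ z := by
  let _ := InnerProductSpace.complexToReal (G := H)
  have hf' := hf.restrictScalars ℝ
  have hg' := hg.restrictScalars ℝ
  have hI : (Pi.single i Complex.I : Fin n → ℂ) = Complex.I • Pi.single i 1 := by
    rw [← Pi.single_smul, smul_eq_mul, mul_one]
  have hI2 := Complex.I_mul_I
  refine ⟨hg'.inner ℂ hf', ?_, ?_⟩
  · simp only [wirtinger]
    rw [fderiv_inner_apply ℂ hg' hf', fderiv_inner_apply ℂ hg' hf', hf.fderiv_restrictScalars ℝ,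
      hg.fderiv_restrictScalars ℝ]
    simp only [ContinuousLinearMap.coe_restrictScalars', hI, map_smul, inner_smul_left,
      inner_smul_right, Complex.conj_I]
    linear_combination (-(⟪g z, fderiv ℂ f z (Pi.single i 1)⟫_ℂ) / 2
      + ⟪fderiv ℂ g z (Pi.single i 1), f z⟫_ℂ / 2) * hI2
  · simp only [wirtingerBar]
    rw [fderiv_inner_apply ℂ hg' hf', fderiv_inner_apply ℂ hg' hf', hf.fderiv_restrictScalars ℝ,
      hg.fderiv_restrictScalars ℝ]
    simp only [ContinuousLinearMap.coe_restrictScalars', hI, map_smul, inner_smul_left,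
      inner_smul_right, Complex.conj_I]
    linear_combination ((⟪g z, fderiv ℂ f z (Pi.single i 1)⟫_ℂ) / 2
      - ⟪fderiv ℂ g z (Pi.single i 1), f z⟫_ℂ / 2) * hI2

end HasWirtingerAt

theorem Filter.EventuallyEq.wirtinger_eq (h : F =ᶠ[𝓝 z] G) (i : Fin n) :
    wirtinger i F z = wirtinger i G z := by
  simp only [wirtinger, h.fderiv_eq]

theorem Filter.EventuallyEq.wirtingerBar_eq (h : F =ᶠ[𝓝 z] G) (i : Fin n) :
    wirtingerBar i F z = wirtingerBar i G z := by
  simp only [wirtingerBar, h.fderiv_eq]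

theorem Filter.EventuallyEq.wirtingerBar (h : F =ᶠ[𝓝 z] G) (i : Fin n) :
    wirtingerBar i F =ᶠ[𝓝 z] wirtingerBar i G :=
  h.eventuallyEq_nhds.mono fun _ hw => hw.wirtingerBar_eq i

end Wirtinger

/-! ### The Bergman metric as a pullback of the Fubini-Study metric. -/

section PullbackMetric

open Filter Topology
open scoped InnerProductSpace

variable {n : ℕ} {H : Type*} [NormedAddCommGroup H] [InnerProductSpace ℂ H]

/-- The pullback of the Fubini-Study metric by a holomorphic map to a Hilbert space. -/
noncomputable def fubiniStudyPullback (Φ : (Fin n → ℂ) → H) (z : Fin n → ℂ) :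
    Matrix (Fin n) (Fin n) ℂ :=
  Matrix.of fun i j =>
    ⟪fderiv ℂ Φ z (Pi.single j 1), fderiv ℂ Φ z (Pi.single i 1)⟫_ℂ * (⟪Φ z, Φ z⟫_ℂ)⁻¹ -
      ⟪fderiv ℂ Φ z (Pi.single j 1), Φ z⟫_ℂ * ⟪Φ z, fderiv ℂ Φ z (Pi.single i 1)⟫_ℂ *
        ((⟪Φ z, Φ z⟫_ℂ)⁻¹ * (⟪Φ z, Φ z⟫_ℂ)⁻¹)

theorem wirtingerBar_log_inner {Φ : (Fin n → ℂ) → H} {z : Fin n → ℂ}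
    (hΦ : DifferentiableAt ℂ Φ z) (h0 : ∀ᶠ w in 𝓝 z, Φ w ≠ 0) (j : Fin n) :
    wirtingerBar j (fun w => (Real.log (⟪Φ w, Φ w⟫_ℂ).re : ℂ)) z =
      ⟪fderiv ℂ Φ z (Pi.single j 1), Φ z⟫_ℂ * (⟪Φ z, Φ z⟫_ℂ)⁻¹ := by
  have he : (fun w => (Real.log (⟪Φ w, Φ w⟫_ℂ).re : ℂ)) =ᶠ[𝓝 z]
      fun w => Complex.log ⟪Φ w, Φ w⟫_ℂ := by
    filter_upwards [h0] with w hw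
    have hre : 0 ≤ (⟪Φ w, Φ w⟫_ℂ).re := inner_self_nonneg (𝕜 := ℂ)
    rw [Complex.ofReal_log hre]
    congr 1
    exact inner_self_ofReal_re (𝕜 := ℂ) (Φ w)
  rw [he.wirtingerBar_eq, ((HasWirtingerAt.inner hΦ hΦ j).clog ?_).wirtingerBar_eq,
    div_eq_mul_inv]
  refine Or.inl ?_
  have hpos : 0 < ‖Φ z‖ ^ 2 := by
    have := norm_pos_iff.mpr h0.self_of_nhds
    positivity
  rw [inner_self_eq_norm_sq_to_K]
  exact_mod_cast hpos

/-- Locally the potential changes by `log |φ|²`, which `∂∂̄` annihilates. This freedom permits the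
normalization at a point used for the curvature. -/
theorem fubiniStudyPullback_smul {Φ : (Fin n → ℂ) → H} {φ : (Fin n → ℂ) → ℂ} {z : Fin n → ℂ}
    (hΦ : DifferentiableAt ℂ Φ z) (hφ : DifferentiableAt ℂ φ z) (h0 : Φ z ≠ 0) (hφ0 : φ z ≠ 0) :
    fubiniStudyPullback (fun w => φ w • Φ w) z = fubiniStudyPullback Φ z := by
  have hN : ⟪Φ z, Φ z⟫_ℂ ≠ 0 := inner_self_ne_zero.mpr h0
  have hc : conj (φ z) ≠ 0 := (map_ne_zero _).mpr hφ0
  ext i j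
  simp only [fubiniStudyPullback, Matrix.of_apply, fderiv_fun_smul hφ hΦ, add_apply, smul_apply,
    ContinuousLinearMap.smulRight_apply, inner_add_left, inner_add_right, inner_smul_left,
    inner_smul_right]
  field_simp
  ring

variable [CompleteSpace H]

theorem wirtinger_wirtingerBar_log_inner {Φ : (Fin n → ℂ) → H} {Ω : Set (Fin n → ℂ)}
    (hΩ : IsOpen Ω) (hΦ : DifferentiableOn ℂ Φ Ω) (h0 : ∀ w ∈ Ω, Φ w ≠ 0) {z : Fin n → ℂ}
    (hz : z ∈ Ω) (i j : Fin n) :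
    wirtinger i (wirtingerBar j fun w => (Real.log (⟪Φ w, Φ w⟫_ℂ).re : ℂ)) z =
      fubiniStudyPullback Φ z i j := by
  have he : (wirtingerBar j fun w => (Real.log (⟪Φ w, Φ w⟫_ℂ).re : ℂ)) =ᶠ[𝓝 z]
      fun w => ⟪fderiv ℂ Φ w (Pi.single j 1), Φ w⟫_ℂ * (⟪Φ w, Φ w⟫_ℂ)⁻¹ := by
    filter_upwards [hΩ.mem_nhds hz] with w hw
    exact wirtingerBar_log_inner (hΦ.differentiableAt (hΩ.mem_nhds hw))
      ((hΩ.eventually_mem hw).mono h0) j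
  have hd := hΦ.differentiableAt (hΩ.mem_nhds hz)
  have hdj := (hΦ.fderiv_apply_of_isOpen hΩ (Pi.single j 1)).differentiableAt (hΩ.mem_nhds hz)
  have hN : ⟪Φ z, Φ z⟫_ℂ ≠ 0 := inner_self_ne_zero.mpr (h0 z hz)
  rw [he.wirtinger_eq, ((HasWirtingerAt.inner hd hdj i).mul
    ((HasWirtingerAt.inner hd hd i).inv hN)).wirtinger_eq]
  simp only [fubiniStudyPullback, Matrix.of_apply]
  field_simp
  ring

end PullbackMetric

/-! ### First and second derivatives of the pullback metric. -/

section Curvature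

open Filter Topology
open scoped InnerProductSpace

theorem HasWirtingerAt.add {n : ℕ} {i : Fin n} {F G : (Fin n → ℂ) → ℂ} {a b c d : ℂ}
    {z : Fin n → ℂ} (hF : HasWirtingerAt i F a b z) (hG : HasWirtingerAt i G c d z) :
    HasWirtingerAt i (fun w => F w + G w) (a + c) (b + d) z := by
  refine ⟨hF.1.add hG.1, ?_, ?_⟩
  · rw [← hF.2, ← hG.2]
    simp only [wirtinger, fderiv_fun_add hF.1 hG.1, add_apply]
    ring
  · rw [← hF.3, ← hG.3]
    simp only [wirtingerBar, fderiv_fun_add hF.1 hG.1, add_apply]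
    ring

variable {n : ℕ} {H : Type*} [NormedAddCommGroup H] [InnerProductSpace ℂ H]
  {Ψ : (Fin n → ℂ) → H} {U : Set (Fin n → ℂ)} {w : Fin n → ℂ}

/-- The derivative of `Ψ` in the `j`-th coordinate direction. -/
noncomputable def coordDeriv (Ψ : (Fin n → ℂ) → H) (j : Fin n) (z : Fin n → ℂ) : H :=
  fderiv ℂ Ψ z (Pi.single j 1)

theorem fderiv_single_eq_coordDeriv (Ψ : (Fin n → ℂ) → H) (j : Fin n) (z : Fin n → ℂ) :
    fderiv ℂ Ψ z (Pi.single j 1) = coordDeriv Ψ j z :=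
  rfl

/-- Stated at an arbitrary point, before any normalization, since the mixed second derivative at `w`
requires the first derivative in a neighbourhood of `w`. -/
theorem hasWirtingerAt_fubiniStudyPullback [CompleteSpace H] (hU : IsOpen U) (hΨ : DifferentiableOn ℂ Ψ U)
    {z : Fin n → ℂ} (hz : z ∈ U) (h0 : Ψ z ≠ 0) (i j l : Fin n) :
    HasWirtingerAt l (fun z => fubiniStudyPullback Ψ z i j)
      (⟪coordDeriv Ψ j z, coordDeriv (coordDeriv Ψ i) l z⟫_ℂ * (⟪Ψ z, Ψ z⟫_ℂ)⁻¹ -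
        ⟪coordDeriv Ψ j z, coordDeriv Ψ i z⟫_ℂ * (⟪Ψ z, coordDeriv Ψ l z⟫_ℂ *
          ((⟪Ψ z, Ψ z⟫_ℂ)⁻¹ * (⟪Ψ z, Ψ z⟫_ℂ)⁻¹)) -
        (⟪coordDeriv Ψ j z, coordDeriv Ψ l z⟫_ℂ * ⟪Ψ z, coordDeriv Ψ i z⟫_ℂ +
          ⟪coordDeriv Ψ j z, Ψ z⟫_ℂ * ⟪Ψ z, coordDeriv (coordDeriv Ψ i) l z⟫_ℂ) *
          ((⟪Ψ z, Ψ z⟫_ℂ)⁻¹ * (⟪Ψ z, Ψ z⟫_ℂ)⁻¹) +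
        ⟪coordDeriv Ψ j z, Ψ z⟫_ℂ * ⟪Ψ z, coordDeriv Ψ i z⟫_ℂ *
          (2 * ⟪Ψ z, coordDeriv Ψ l z⟫_ℂ * (⟪Ψ z, Ψ z⟫_ℂ)⁻¹ ^ 3))
      (⟪coordDeriv (coordDeriv Ψ j) l z, coordDeriv Ψ i z⟫_ℂ * (⟪Ψ z, Ψ z⟫_ℂ)⁻¹ -
        ⟪coordDeriv Ψ j z, coordDeriv Ψ i z⟫_ℂ * (⟪coordDeriv Ψ l z, Ψ z⟫_ℂ *
          ((⟪Ψ z, Ψ z⟫_ℂ)⁻¹ * (⟪Ψ z, Ψ z⟫_ℂ)⁻¹)) -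
        (⟪coordDeriv (coordDeriv Ψ j) l z, Ψ z⟫_ℂ * ⟪Ψ z, coordDeriv Ψ i z⟫_ℂ +
          ⟪coordDeriv Ψ j z, Ψ z⟫_ℂ * ⟪coordDeriv Ψ l z, coordDeriv Ψ i z⟫_ℂ) *
          ((⟪Ψ z, Ψ z⟫_ℂ)⁻¹ * (⟪Ψ z, Ψ z⟫_ℂ)⁻¹) +
        ⟪coordDeriv Ψ j z, Ψ z⟫_ℂ * ⟪Ψ z, coordDeriv Ψ i z⟫_ℂ *
          (2 * ⟪coordDeriv Ψ l z, Ψ z⟫_ℂ * (⟪Ψ z, Ψ z⟫_ℂ)⁻¹ ^ 3)) z := by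
  have hd := hΨ.differentiableAt (hU.mem_nhds hz)
  have hdi : ∀ i, DifferentiableAt ℂ (coordDeriv Ψ i) z := fun i =>
    (hΨ.fderiv_apply_of_isOpen hU (Pi.single i 1)).differentiableAt (hU.mem_nhds hz)
  have hN : ⟪Ψ z, Ψ z⟫_ℂ ≠ 0 := inner_self_ne_zero.mpr h0
  have hI := (HasWirtingerAt.inner hd hd l).inv hN
  have h := ((HasWirtingerAt.inner (hdi i) (hdi j) l).mul hI).sub
    (((HasWirtingerAt.inner hd (hdi j) l).mul (HasWirtingerAt.inner (hdi i) hd l)).mul (hI.mul hI))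
  refine ⟨h.1, h.2.trans ?_, h.3.trans ?_⟩
  · simp only [fderiv_single_eq_coordDeriv]
    field_simp
    ring
  · simp only [fderiv_single_eq_coordDeriv]
    field_simp
    ring

theorem inner_coordDeriv_eq_zero (hU : IsOpen U) (hΨ : DifferentiableOn ℂ Ψ U) {v : H} {c : ℂ}
    (hc : ∀ z ∈ U, ⟪v, Ψ z⟫_ℂ = c) {z : Fin n → ℂ} (hz : z ∈ U) (i : Fin n) :
    ⟪v, coordDeriv Ψ i z⟫_ℂ = 0 := by
  have hd := hΨ.differentiableAt (hU.mem_nhds hz)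
  have h1 : HasFDerivAt (fun y => ⟪v, Ψ y⟫_ℂ) ((innerSL ℂ v).comp (fderiv ℂ Ψ z)) z :=
    (innerSL ℂ v).hasFDerivAt.comp z hd.hasFDerivAt
  have h2 : (fun y => ⟪v, Ψ y⟫_ℂ) =ᶠ[𝓝 z] fun _ => c := by
    filter_upwards [hU.mem_nhds hz] with y hy using hc y hy
  have h3 := h1.fderiv.symm.trans h2.fderiv_eq
  have := congrArg (fun L => L (Pi.single i 1)) h3
  simpa [fderiv_single_eq_coordDeriv] using this

/-- First and mixed second derivatives of the pullback metric at a point `w` at which `Ψ` is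
normalized, that is, `⟪Ψ w, Ψ z⟫` does not depend on `z`. -/
theorem fubiniStudyPullback_derivatives [CompleteSpace H] (hU : IsOpen U) (hΨ : DifferentiableOn ℂ Ψ U)
    (hw : w ∈ U) (h0 : ∀ z ∈ U, Ψ z ≠ 0) (hc : ∀ z ∈ U, ⟪Ψ w, Ψ z⟫_ℂ = ⟪Ψ w, Ψ w⟫_ℂ)
    (i j k l : Fin n) :
    fubiniStudyPullback Ψ w i j =
        ⟪coordDeriv Ψ j w, coordDeriv Ψ i w⟫_ℂ * (⟪Ψ w, Ψ w⟫_ℂ)⁻¹ ∧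
      wirtinger k (fun z => fubiniStudyPullback Ψ z i j) w =
        ⟪coordDeriv Ψ j w, coordDeriv (coordDeriv Ψ i) k w⟫_ℂ * (⟪Ψ w, Ψ w⟫_ℂ)⁻¹ ∧
      wirtingerBar l (fun z => fubiniStudyPullback Ψ z i j) w =
        ⟪coordDeriv (coordDeriv Ψ j) l w, coordDeriv Ψ i w⟫_ℂ * (⟪Ψ w, Ψ w⟫_ℂ)⁻¹ ∧
      wirtinger k (wirtingerBar l fun z => fubiniStudyPullback Ψ z i j) w =
        ⟪coordDeriv (coordDeriv Ψ j) l w, coordDeriv (coordDeriv Ψ i) k w⟫_ℂ * (⟪Ψ w, Ψ w⟫_ℂ)⁻¹ -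
        (⟪coordDeriv Ψ j w, coordDeriv Ψ i w⟫_ℂ * ⟪coordDeriv Ψ l w, coordDeriv Ψ k w⟫_ℂ +
          ⟪coordDeriv Ψ j w, coordDeriv Ψ k w⟫_ℂ * ⟪coordDeriv Ψ l w, coordDeriv Ψ i w⟫_ℂ) *
          ((⟪Ψ w, Ψ w⟫_ℂ)⁻¹ * (⟪Ψ w, Ψ w⟫_ℂ)⁻¹) := by
  have hz1 : ∀ z ∈ U, ∀ i, ⟪Ψ w, coordDeriv Ψ i z⟫_ℂ = 0 := fun z hz i =>
    inner_coordDeriv_eq_zero hU hΨ hc hz i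
  have hdi : ∀ i, DifferentiableOn ℂ (coordDeriv Ψ i) U := fun i =>
    hΨ.fderiv_apply_of_isOpen hU (Pi.single i 1)
  have hz2 : ∀ i k, ⟪Ψ w, coordDeriv (coordDeriv Ψ i) k w⟫_ℂ = 0 := fun i k =>
    inner_coordDeriv_eq_zero hU (hdi i) (fun z hz => hz1 z hz i) hw k
  have hz1' : ∀ i, ⟪coordDeriv Ψ i w, Ψ w⟫_ℂ = 0 := fun i => by
    rw [← inner_conj_symm, hz1 w hw i, map_zero]
  have hz2' : ∀ i k, ⟪coordDeriv (coordDeriv Ψ i) k w, Ψ w⟫_ℂ = 0 := fun i k => by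
    rw [← inner_conj_symm, hz2 i k, map_zero]
  refine ⟨?_, ?_, ?_, ?_⟩
  · have : fubiniStudyPullback Ψ w i j =
        ⟪coordDeriv Ψ j w, coordDeriv Ψ i w⟫_ℂ * (⟪Ψ w, Ψ w⟫_ℂ)⁻¹ -
        ⟪coordDeriv Ψ j w, Ψ w⟫_ℂ * ⟪Ψ w, coordDeriv Ψ i w⟫_ℂ *
          ((⟪Ψ w, Ψ w⟫_ℂ)⁻¹ * (⟪Ψ w, Ψ w⟫_ℂ)⁻¹) := rfl
    rw [this, hz1 w hw]
    ring
  · rw [(hasWirtingerAt_fubiniStudyPullback hU hΨ hw (h0 w hw) i j k).wirtinger_eq]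
    simp only [hz1 w hw, hz1']
    ring
  · rw [(hasWirtingerAt_fubiniStudyPullback hU hΨ hw (h0 w hw) i j l).wirtingerBar_eq]
    simp only [hz1 w hw, hz1']
    ring
  · have he := Filter.eventuallyEq_of_mem (hU.mem_nhds hw) fun z hz =>
      (hasWirtingerAt_fubiniStudyPullback hU hΨ hz (h0 z hz) i j l).wirtingerBar_eq
    rw [he.wirtinger_eq]
    have hd := hΨ.differentiableAt (hU.mem_nhds hw)
    have hd1 : ∀ i, DifferentiableAt ℂ (coordDeriv Ψ i) w := fun i =>
      (hdi i).differentiableAt (hU.mem_nhds hw)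
    have hd2 : ∀ i k, DifferentiableAt ℂ (coordDeriv (coordDeriv Ψ i) k) w := fun i k =>
      ((hdi i).fderiv_apply_of_isOpen hU (Pi.single k 1)).differentiableAt (hU.mem_nhds hw)
    have hN : ⟪Ψ w, Ψ w⟫_ℂ ≠ 0 := inner_self_ne_zero.mpr (h0 w hw)
    have hI := (HasWirtingerAt.inner hd hd k).inv hN
    have hII := hI.mul hI
    -- Only differentiability of this factor matters. Its cofactor `⟪coordDeriv Ψ j z, Ψ z⟫ * ⟪Ψ z,
    -- coordDeriv Ψ i z⟫` is a product of two functions vanishing at `w`, so it vanishes there with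
    -- its first derivatives.
    have hm : HasWirtingerAt k (fun z => 2 * ⟪coordDeriv Ψ l z, Ψ z⟫_ℂ * (⟪Ψ z, Ψ z⟫_ℂ)⁻¹ ^ 3)
        _ _ w := ⟨?_, rfl, rfl⟩
    · have h := (((HasWirtingerAt.inner (hd1 i) (hd2 j l) k).mul hI).sub
        ((HasWirtingerAt.inner (hd1 i) (hd1 j) k).mul
          ((HasWirtingerAt.inner hd (hd1 l) k).mul hII))).sub
        ((((HasWirtingerAt.inner hd (hd2 j l) k).mul (HasWirtingerAt.inner (hd1 i) hd k)).add
          ((HasWirtingerAt.inner hd (hd1 j) k).mul (HasWirtingerAt.inner (hd1 i) (hd1 l) k))).mul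
            hII)
      have h' := h.add (((HasWirtingerAt.inner hd (hd1 j) k).mul
        (HasWirtingerAt.inner (hd1 i) hd k)).mul hm)
      rw [h'.wirtinger_eq]
      simp only [fderiv_single_eq_coordDeriv, hz1 w hw, hz1', hz2, hz2']
      ring
    · have hl := (HasWirtingerAt.inner hd (hd1 l) k).1
      have hi := hI.1
      exact ((differentiableAt_const 2).mul hl).mul (hi.pow 3)

end Curvature

/-! ### Multilinear identities, polarization, and positivity at a normalized point. -/

section CurvatureBound

open Filter Topology
open scoped InnerProductSpace

variable {n : ℕ} {H : Type*} [NormedAddCommGroup H] [InnerProductSpace ℂ H]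

theorem inner_sum_smul_sum_smul (P Q : Fin n → H) (ξ η : Fin n → ℂ) :
    ⟪∑ j, η j • Q j, ∑ i, ξ i • P i⟫_ℂ = ∑ i, ∑ j, ⟪Q j, P i⟫_ℂ * ξ i * conj (η j) := by
  simp only [inner_sum, sum_inner, inner_smul_left, inner_smul_right, Finset.mul_sum]
  exact Finset.sum_congr rfl fun i _ => Finset.sum_congr rfl fun j _ => by ring

theorem inner_sum_sum_smul (A B : Fin n → Fin n → H) (ξ η ζ θ : Fin n → ℂ) :
    ⟪∑ j, ∑ l, (η j * θ l) • A j l, ∑ i, ∑ k, (ξ i * ζ k) • B i k⟫_ℂ =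
      ∑ i, ∑ j, ∑ k, ∑ l, ⟪A j l, B i k⟫_ℂ * ξ i * conj (η j) * ζ k * conj (θ l) := by
  simp only [inner_sum, sum_inner, inner_smul_left, inner_smul_right, Finset.mul_sum, map_mul]
  refine Finset.sum_congr rfl fun i _ => ?_
  rw [Finset.sum_comm]
  exact Finset.sum_congr rfl fun j _ => Finset.sum_congr rfl fun k _ =>
    Finset.sum_congr rfl fun l _ => by ring

theorem sum_mul_eq_inner_mul_inner (P : Fin n → H) (ξ η ζ θ : Fin n → ℂ) :
    ∑ i, ∑ j, ∑ k, ∑ l,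
        ⟪P j, P i⟫_ℂ * ⟪P l, P k⟫_ℂ * ξ i * conj (η j) * ζ k * conj (θ l) =
      ⟪∑ j, η j • P j, ∑ i, ξ i • P i⟫_ℂ * ⟪∑ l, θ l • P l, ∑ k, ζ k • P k⟫_ℂ := by
  rw [mul_comm]
  simp only [inner_sum_smul_sum_smul, Finset.sum_mul, Finset.mul_sum]
  exact Finset.sum_congr rfl fun i _ => Finset.sum_congr rfl fun j _ =>
    Finset.sum_congr rfl fun k _ => Finset.sum_congr rfl fun l _ => by ring

theorem sum_mul_eq_inner_mul_inner' (P : Fin n → H) (ξ η ζ θ : Fin n → ℂ) :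
    ∑ i, ∑ j, ∑ k, ∑ l,
        ⟪P j, P k⟫_ℂ * ⟪P l, P i⟫_ℂ * ξ i * conj (η j) * ζ k * conj (θ l) =
      ⟪∑ j, η j • P j, ∑ k, ζ k • P k⟫_ℂ * ⟪∑ l, θ l • P l, ∑ i, ξ i • P i⟫_ℂ := by
  rw [← sum_mul_eq_inner_mul_inner]
  have h : ∀ f : Fin n → Fin n → Fin n → ℂ,
      ∑ i, ∑ j, ∑ k, f i j k = ∑ k, ∑ j, ∑ i, f i j k := by
    intro f
    rw [Finset.sum_comm]
    rw [Finset.sum_congr rfl fun j _ => Finset.sum_comm]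
    rw [Finset.sum_comm]
  rw [h]
  exact Finset.sum_congr rfl fun i _ => Finset.sum_congr rfl fun j _ =>
    Finset.sum_congr rfl fun k _ => Finset.sum_congr rfl fun l _ => by ring

/-- Polarization of a bound for a symmetric bilinear form by the square of a Hilbert norm. -/
theorem norm_le_of_norm_self_le {E : Type*} [AddCommGroup E] [Module ℂ E] (D : E →ₗ[ℂ] H)
    (hD : ∀ ξ, D ξ = 0 → ξ = 0) (B : E →ₗ[ℂ] E →ₗ[ℂ] ℂ) (hB : ∀ ξ ζ, B ξ ζ = B ζ ξ) {c : ℝ}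
    (hc : ∀ ξ, ‖B ξ ξ‖ ≤ c * ‖D ξ‖ ^ 2) (ξ ζ : E) : ‖B ξ ζ‖ ≤ c * (‖D ξ‖ * ‖D ζ‖) := by
  have h1 : ∀ ξ ζ, ‖B ξ ζ‖ ≤ c / 2 * (‖D ξ‖ ^ 2 + ‖D ζ‖ ^ 2) := by
    intro ξ ζ
    have e : 4 * B ξ ζ = B (ξ + ζ) (ξ + ζ) - B (ξ - ζ) (ξ - ζ) := by
      simp only [map_add, map_sub, LinearMap.add_apply, LinearMap.sub_apply, hB ζ ξ]
      ring
    have h2 := norm_sub_le (B (ξ + ζ) (ξ + ζ)) (B (ξ - ζ) (ξ - ζ))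
    rw [← e, norm_mul, Complex.norm_ofNat] at h2
    have h3 := hc (ξ + ζ)
    have h4 := hc (ξ - ζ)
    rw [map_add D] at h3
    rw [map_sub D] at h4
    have h5 := parallelogram_law_with_norm ℂ (D ξ) (D ζ)
    have h6 : c * ‖D ξ + D ζ‖ ^ 2 + c * ‖D ξ - D ζ‖ ^ 2 = 2 * c * (‖D ξ‖ ^ 2 + ‖D ζ‖ ^ 2) := by
      linear_combination c * h5
    linarith
  by_cases hξ : D ξ = 0
  · simp [hD ξ hξ]
  by_cases hζ : D ζ = 0
  · simp [hD ζ hζ]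
  have ha : 0 < ‖D ξ‖ := norm_pos_iff.mpr hξ
  have hb : 0 < ‖D ζ‖ := norm_pos_iff.mpr hζ
  -- Rescaling gives both vectors the same `D`-length, where the arithmetic mean bound `h1` equals
  -- the product bound; the constant is unchanged.
  have h2 := h1 ((‖D ζ‖ : ℂ) • ξ) ((‖D ξ‖ : ℂ) • ζ)
  simp only [map_smul, LinearMap.smul_apply, smul_eq_mul, norm_mul, norm_smul, Complex.norm_real,
    norm_norm] at h2
  refine le_of_mul_le_mul_left ?_ (mul_pos ha hb)
  linarith

variable {Ψ : (Fin n → ℂ) → H} {U : Set (Fin n → ℂ)} {w : Fin n → ℂ}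

theorem fderiv_apply_eq_sum_coordDeriv (Ψ : (Fin n → ℂ) → H) (w ξ : Fin n → ℂ) :
    fderiv ℂ Ψ w ξ = ∑ i, ξ i • coordDeriv Ψ i w := by
  conv_lhs => rw [← Finset.univ_sum_single ξ]
  rw [map_sum]
  refine Finset.sum_congr rfl fun i _ => ?_
  rw [coordDeriv, ← map_smul, ← Pi.single_smul, smul_eq_mul, mul_one]

theorem hermitianLength_fubiniStudyPullback (hc : ∀ i, ⟪Ψ w, coordDeriv Ψ i w⟫_ℂ = 0)
    (ξ : Fin n → ℂ) :
    hermitianLength (fubiniStudyPullback Ψ) w ξ = ‖fderiv ℂ Ψ w ξ‖ / ‖Ψ w‖ := by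
  have h : ∑ i, ∑ j, fubiniStudyPullback Ψ w i j * ξ i * conj (ξ j) =
      ⟪fderiv ℂ Ψ w ξ, fderiv ℂ Ψ w ξ⟫_ℂ * (⟪Ψ w, Ψ w⟫_ℂ)⁻¹ := by
    rw [fderiv_apply_eq_sum_coordDeriv, inner_sum_smul_sum_smul]
    simp only [Finset.sum_mul]
    refine Finset.sum_congr rfl fun i _ => Finset.sum_congr rfl fun j _ => ?_
    simp only [fubiniStudyPullback, Matrix.of_apply, fderiv_single_eq_coordDeriv, hc]
    ring
  rw [hermitianLength, h, inner_self_eq_norm_sq_to_K, inner_self_eq_norm_sq_to_K]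
  have : (((‖fderiv ℂ Ψ w ξ‖ : ℂ) ^ 2 * ((‖Ψ w‖ : ℂ) ^ 2)⁻¹)).re =
      (‖fderiv ℂ Ψ w ξ‖ / ‖Ψ w‖) ^ 2 := by
    rw [div_pow, div_eq_mul_inv]
    exact_mod_cast Complex.ofReal_re _
  erw [this]
  rw [Real.sqrt_sq (by positivity)]

theorem posDef_fubiniStudyPullback (hc : ∀ i, ⟪Ψ w, coordDeriv Ψ i w⟫_ℂ = 0) (h0 : Ψ w ≠ 0)
    (hD : ∀ ξ, fderiv ℂ Ψ w ξ = 0 → ξ = 0) : (fubiniStudyPullback Ψ w).PosDef := by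
  have hij : ∀ i j, fubiniStudyPullback Ψ w i j =
      ⟪coordDeriv Ψ j w, coordDeriv Ψ i w⟫_ℂ * ((‖Ψ w‖ ^ 2)⁻¹ : ℝ) := by
    intro i j
    simp only [fubiniStudyPullback, Matrix.of_apply, fderiv_single_eq_coordDeriv, hc]
    rw [inner_self_eq_norm_sq_to_K]
    push_cast
    simp
  refine Matrix.PosDef.of_dotProduct_mulVec_pos ?_ fun x hx => ?_
  · ext i j
    rw [Matrix.conjTranspose_apply, hij, hij, star_mul', RCLike.star_def, inner_conj_symm,
      Complex.conj_ofReal]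
  -- The matrix form conjugates the index `i`, while the metric conjugates `j`; hence the tangent
  -- vector is `star x`.
  · have h : star x ⬝ᵥ (fubiniStudyPullback Ψ w).mulVec x =
        ⟪fderiv ℂ Ψ w (star x), fderiv ℂ Ψ w (star x)⟫_ℂ * ((‖Ψ w‖ ^ 2)⁻¹ : ℝ) := by
      rw [fderiv_apply_eq_sum_coordDeriv, inner_sum_smul_sum_smul]
      simp only [dotProduct, Matrix.mulVec, Finset.sum_mul, Finset.mul_sum, hij]
      refine Finset.sum_congr rfl fun i _ => Finset.sum_congr rfl fun j _ => ?_
      simp only [Pi.star_apply, RCLike.star_def, Complex.conj_conj]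
      ring
    have h1 : 0 < ‖fderiv ℂ Ψ w (star x)‖ ^ 2 * (‖Ψ w‖ ^ 2)⁻¹ := by
      have h2 : 0 < ‖fderiv ℂ Ψ w (star x)‖ :=
        norm_pos_iff.mpr fun h => hx (star_eq_zero.mp (hD _ h))
      have h3 := norm_pos_iff.mpr h0
      positivity
    rw [h, inner_self_eq_norm_sq_to_K]
    refine lt_of_lt_of_eq (Complex.zero_lt_real.mpr h1) ?_
    push_cast
    rfl

end CurvatureBound

/-! ### Gauss equation and curvature bound at a normalized point. -/

section NormalizedCurvature

open Filter Topology
open scoped InnerProductSpace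

variable {n : ℕ} {H : Type*} [NormedAddCommGroup H] [InnerProductSpace ℂ H]

theorem norm_inner_self_eq_norm_sq (x : H) : ‖⟪x, x⟫_ℂ‖ = ‖x‖ ^ 2 := by
  rw [inner_self_eq_norm_sq_to_K]
  simp

/-- The orthogonal projection to the span of the vectors `P a`, expressed through the inverse `G⁻¹`
of the matrix `G a b = ⟪P b, P a⟫ * M`. -/
noncomputable def gramProjection (P : Fin n → H) (M : ℂ) (G : Matrix (Fin n) (Fin n) ℂ) :
    H →ₗ[ℂ] H where
  toFun v := ∑ a, ∑ b, (G⁻¹ a b * (⟪P a, v⟫_ℂ * M)) • P b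
  map_add' v v' := by
    simp only [inner_add_right, add_mul, mul_add, add_smul, Finset.sum_add_distrib]
  map_smul' c v := by
    simp only [inner_smul_right, Finset.smul_sum, smul_smul, RingHom.id_apply]
    exact Finset.sum_congr rfl fun a _ => Finset.sum_congr rfl fun b _ => by congr 1; ring

theorem gramProjection_apply (P : Fin n → H) (M : ℂ) (G : Matrix (Fin n) (Fin n) ℂ) (v : H) :
    gramProjection P M G v = ∑ a, ∑ b, (G⁻¹ a b * (⟪P a, v⟫_ℂ * M)) • P b :=
  rfl

/-- `G` is the Gram matrix of the `P a` up to the factor `M`, so pairing the projection with `P c`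
produces `G⁻¹ * G`. -/
theorem inner_sub_gramProjection {P : Fin n → H} {M : ℂ} {G : Matrix (Fin n) (Fin n) ℂ}
    (hG : ∀ a b, G a b = ⟪P b, P a⟫_ℂ * M) (hdet : IsUnit G.det) (hM : M ≠ 0) (c : Fin n) (v : H) :
    ⟪P c, v - gramProjection P M G v⟫_ℂ = 0 := by
  have h : ⟪P c, gramProjection P M G v⟫_ℂ * M = ⟪P c, v⟫_ℂ * M := by
    rw [gramProjection_apply]
    simp only [inner_sum, inner_smul_right, Finset.sum_mul]
    calc ∑ a, ∑ b, G⁻¹ a b * (⟪P a, v⟫_ℂ * M) * ⟪P c, P b⟫_ℂ * M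
        = ∑ a, (⟪P a, v⟫_ℂ * M) * (G⁻¹ * G) a c := by
          refine Finset.sum_congr rfl fun a _ => ?_
          rw [Matrix.mul_apply, Finset.mul_sum]
          refine Finset.sum_congr rfl fun b _ => ?_
          rw [hG]
          ring
      _ = ⟪P c, v⟫_ℂ * M := by
          rw [Matrix.nonsing_inv_mul _ hdet]
          simp [Matrix.one_apply]
  rw [inner_sub_right, sub_eq_zero]
  exact (mul_right_cancel₀ hM h).symm

theorem inner_gramProjection_eq_zero {P : Fin n → H} {M : ℂ} {G : Matrix (Fin n) (Fin n) ℂ} {u : H}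
    (hu : ∀ c, ⟪P c, u⟫_ℂ = 0) (v : H) : ⟪gramProjection P M G v, u⟫_ℂ = 0 := by
  rw [gramProjection_apply]
  simp only [sum_inner, inner_smul_left, hu, mul_zero, Finset.sum_const_zero]

variable [CompleteSpace H] {Ψ : (Fin n → ℂ) → H} {U : Set (Fin n → ℂ)} {w : Fin n → ℂ}

theorem coordDeriv_coordDeriv_eq (hU : IsOpen U) (hΨ : DifferentiableOn ℂ Ψ U) (hw : w ∈ U)
    (i k : Fin n) : coordDeriv (coordDeriv Ψ i) k w =
      fderiv ℂ (fderiv ℂ Ψ) w (Pi.single k 1) (Pi.single i 1) := by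
  have h2 : DifferentiableAt ℂ (fderiv ℂ Ψ) w :=
    (((hΨ.contDiffOn_of_finiteDimensional hU).fderiv_of_isOpen hU
      (m := 1) (by norm_cast)).differentiableOn one_ne_zero).differentiableAt (hU.mem_nhds hw)
  change fderiv ℂ (fun z => fderiv ℂ Ψ z (Pi.single i 1)) w (Pi.single k 1) = _
  rw [fderiv_clm_apply h2 (differentiableAt_const _)]
  simp

theorem fderiv_fderiv_eq_sum (hU : IsOpen U) (hΨ : DifferentiableOn ℂ Ψ U) (hw : w ∈ U)
    (ξ ζ : Fin n → ℂ) : fderiv ℂ (fderiv ℂ Ψ) w ζ ξ =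
      ∑ i, ∑ k, (ξ i * ζ k) • coordDeriv (coordDeriv Ψ i) k w := by
  have hs : ∀ ξ : Fin n → ℂ, ξ = ∑ i, ξ i • Pi.single i (1 : ℂ) := fun ξ => by
    conv_lhs => rw [← Finset.univ_sum_single ξ]
    refine Finset.sum_congr rfl fun i _ => ?_
    rw [← Pi.single_smul, smul_eq_mul, mul_one]
  conv_lhs => rw [hs ξ, hs ζ]
  simp only [map_sum, map_smul, sum_apply, smul_apply, coordDeriv_coordDeriv_eq hU hΨ hw,
    Finset.smul_sum, smul_smul]

theorem fderiv_fderiv_comm (hU : IsOpen U) (hΨ : DifferentiableOn ℂ Ψ U) (hw : w ∈ U)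
    (ξ ζ : Fin n → ℂ) : fderiv ℂ (fderiv ℂ Ψ) w ζ ξ = fderiv ℂ (fderiv ℂ Ψ) w ξ ζ := by
  have h : ContDiffAt ℂ ∞ Ψ w :=
    (hΨ.contDiffOn_of_finiteDimensional hU).contDiffAt (hU.mem_nhds hw)
  refine h.isSymmSndFDerivAt ?_ ζ ξ
  simp only [minSmoothness_of_isRCLikeNormedField]
  norm_cast

/-- The curvature tensor of the pullback metric at a normalized point, in terms of the component of
the second derivatives orthogonal to the first derivatives. -/
theorem chernCurvatureForm_fubiniStudyPullback (hU : IsOpen U) (hΨ : DifferentiableOn ℂ Ψ U)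
    (hw : w ∈ U) (h0 : ∀ z ∈ U, Ψ z ≠ 0) (hc : ∀ z ∈ U, ⟪Ψ w, Ψ z⟫_ℂ = ⟪Ψ w, Ψ w⟫_ℂ)
    (ξ η ζ θ : Fin n → ℂ) :
    chernCurvatureForm (fubiniStudyPullback Ψ) w ξ η ζ θ =
      (⟪fderiv ℂ Ψ w η, fderiv ℂ Ψ w ξ⟫_ℂ * ⟪fderiv ℂ Ψ w θ, fderiv ℂ Ψ w ζ⟫_ℂ +
        ⟪fderiv ℂ Ψ w η, fderiv ℂ Ψ w ζ⟫_ℂ * ⟪fderiv ℂ Ψ w θ, fderiv ℂ Ψ w ξ⟫_ℂ) *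
          (⟪Ψ w, Ψ w⟫_ℂ)⁻¹ ^ 2 -
      ⟪fderiv ℂ (fderiv ℂ Ψ) w θ η, fderiv ℂ (fderiv ℂ Ψ) w ζ ξ -
        gramProjection (fun a => coordDeriv Ψ a w) (⟪Ψ w, Ψ w⟫_ℂ)⁻¹ (fubiniStudyPullback Ψ w)
          (fderiv ℂ (fderiv ℂ Ψ) w ζ ξ)⟫_ℂ * (⟪Ψ w, Ψ w⟫_ℂ)⁻¹ := by
  set M := (⟪Ψ w, Ψ w⟫_ℂ)⁻¹ with hM
  set pr := gramProjection (fun a => coordDeriv Ψ a w) M (fubiniStudyPullback Ψ w) with hpr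
  have hR : ∀ i j k l, chernCurvature (fubiniStudyPullback Ψ) w i j k l =
      ⟪coordDeriv Ψ j w, coordDeriv Ψ i w⟫_ℂ * ⟪coordDeriv Ψ l w, coordDeriv Ψ k w⟫_ℂ * M ^ 2 +
      ⟪coordDeriv Ψ j w, coordDeriv Ψ k w⟫_ℂ * ⟪coordDeriv Ψ l w, coordDeriv Ψ i w⟫_ℂ * M ^ 2 -
      ⟪coordDeriv (coordDeriv Ψ j) l w, coordDeriv (coordDeriv Ψ i) k w -
        pr (coordDeriv (coordDeriv Ψ i) k w)⟫_ℂ * M := by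
    intro i j k l
    rw [chernCurvature, (fubiniStudyPullback_derivatives hU hΨ hw h0 hc i j k l).2.2.2]
    -- The quadratic term of the Chern curvature is the part of the second derivatives tangent to
    -- the image, so adding it leaves only the normal part.
    have h : ∑ a, ∑ b, (fubiniStudyPullback Ψ w)⁻¹ a b *
        wirtinger k (fun z => fubiniStudyPullback Ψ z i a) w *
        wirtingerBar l (fun z => fubiniStudyPullback Ψ z b j) w =
        ⟪coordDeriv (coordDeriv Ψ j) l w, pr (coordDeriv (coordDeriv Ψ i) k w)⟫_ℂ * M := by
      rw [hpr, gramProjection_apply]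
      simp only [inner_sum, inner_smul_right, Finset.sum_mul]
      refine Finset.sum_congr rfl fun a _ => Finset.sum_congr rfl fun b _ => ?_
      rw [(fubiniStudyPullback_derivatives hU hΨ hw h0 hc i a k l).2.1,
        (fubiniStudyPullback_derivatives hU hΨ hw h0 hc b j k l).2.2.1]
      ring
    rw [h, inner_sub_right, ← hM]
    ring
  have hS : fderiv ℂ (fderiv ℂ Ψ) w ζ ξ - pr (fderiv ℂ (fderiv ℂ Ψ) w ζ ξ) =
      ∑ i, ∑ k, (ξ i * ζ k) • (coordDeriv (coordDeriv Ψ i) k w -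
        pr (coordDeriv (coordDeriv Ψ i) k w)) := by
    rw [fderiv_fderiv_eq_sum hU hΨ hw]
    simp only [map_sum, map_smul, smul_sub, Finset.sum_sub_distrib]
  rw [hS, fderiv_fderiv_eq_sum hU hΨ hw η θ, inner_sum_sum_smul, chernCurvatureForm, add_mul]
  simp only [fderiv_apply_eq_sum_coordDeriv]
  rw [← sum_mul_eq_inner_mul_inner, ← sum_mul_eq_inner_mul_inner']
  simp only [Finset.sum_mul, ← Finset.sum_add_distrib, ← Finset.sum_sub_distrib]
  refine Finset.sum_congr rfl fun i _ => Finset.sum_congr rfl fun j _ =>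
    Finset.sum_congr rfl fun k _ => Finset.sum_congr rfl fun l _ => ?_
  rw [hR]
  ring

/-- The curvature of the pullback metric is controlled by the second derivatives of `Ψ` in
directions orthogonal to its first order jet. -/
theorem norm_chernCurvatureForm_fubiniStudyPullback_le (hU : IsOpen U)
    (hΨ : DifferentiableOn ℂ Ψ U) (hw : w ∈ U) (h0 : ∀ z ∈ U, Ψ z ≠ 0)
    (hc : ∀ z ∈ U, ⟪Ψ w, Ψ z⟫_ℂ = ⟪Ψ w, Ψ w⟫_ℂ) (hD : ∀ ξ, fderiv ℂ Ψ w ξ = 0 → ξ = 0) {C : ℝ}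
    (hC0 : 0 ≤ C)
    (hC : ∀ u, ⟪u, Ψ w⟫_ℂ = 0 → (∀ v, ⟪u, fderiv ℂ Ψ w v⟫_ℂ = 0) → ∀ ξ,
      ‖⟪u, fderiv ℂ (fderiv ℂ Ψ) w ξ ξ⟫_ℂ‖ ≤ C * ‖u‖ * ‖fderiv ℂ Ψ w ξ‖ ^ 2 / ‖Ψ w‖)
    (ξ η ζ θ : Fin n → ℂ) :
    ‖chernCurvatureForm (fubiniStudyPullback Ψ) w ξ η ζ θ‖ ≤ (2 + C ^ 2) *
      (hermitianLength (fubiniStudyPullback Ψ) w ξ * hermitianLength (fubiniStudyPullback Ψ) w η *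
        hermitianLength (fubiniStudyPullback Ψ) w ζ *
        hermitianLength (fubiniStudyPullback Ψ) w θ) := by
  have hz1 : ∀ i, ⟪Ψ w, coordDeriv Ψ i w⟫_ℂ = 0 := fun i =>
    inner_coordDeriv_eq_zero hU hΨ hc hw i
  have hz2 : ∀ i k, ⟪Ψ w, coordDeriv (coordDeriv Ψ i) k w⟫_ℂ = 0 := fun i k =>
    inner_coordDeriv_eq_zero hU (hΨ.fderiv_apply_of_isOpen hU (Pi.single i 1))
      (fun z hz => inner_coordDeriv_eq_zero hU hΨ hc hz i) hw k
  have hpd := posDef_fubiniStudyPullback hz1 (h0 w hw) hD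
  have hN : ⟪Ψ w, Ψ w⟫_ℂ ≠ 0 := inner_self_ne_zero.mpr (h0 w hw)
  have hΨpos : 0 < ‖Ψ w‖ := norm_pos_iff.mpr (h0 w hw)
  rw [chernCurvatureForm_fubiniStudyPullback hU hΨ hw h0 hc]
  simp only [hermitianLength_fubiniStudyPullback hz1]
  set M := (⟪Ψ w, Ψ w⟫_ℂ)⁻¹ with hM
  have hMnorm : ‖M‖ = (‖Ψ w‖ ^ 2)⁻¹ := by
    rw [hM, norm_inv, norm_inner_self_eq_norm_sq]
  set pr := gramProjection (fun a => coordDeriv Ψ a w) M (fubiniStudyPullback Ψ w) with hpr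
  have hG : ∀ a b, fubiniStudyPullback Ψ w a b = ⟪coordDeriv Ψ b w, coordDeriv Ψ a w⟫_ℂ * M :=
    fun a b => (fubiniStudyPullback_derivatives hU hΨ hw h0 hc a b a a).1
  have hdet : IsUnit (fubiniStudyPullback Ψ w).det := isUnit_iff_ne_zero.mpr hpd.det_pos.ne'
  have horth : ∀ c v, ⟪coordDeriv Ψ c w, v - pr v⟫_ℂ = 0 := fun c v =>
    inner_sub_gramProjection hG hdet (inv_ne_zero hN) c v
  -- The normal component `u` is its own test vector: it is orthogonal to the 1-jet, and its pairing
  -- with the second derivative is `‖u‖²`. Polarizing `hC` and dividing by `‖u‖` bounds it.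
  have hV : ∀ ξ ζ, ‖fderiv ℂ (fderiv ℂ Ψ) w ζ ξ - pr (fderiv ℂ (fderiv ℂ Ψ) w ζ ξ)‖ ≤
      C / ‖Ψ w‖ * (‖fderiv ℂ Ψ w ξ‖ * ‖fderiv ℂ Ψ w ζ‖) := by
    intro ξ ζ
    set u := fderiv ℂ (fderiv ℂ Ψ) w ζ ξ - pr (fderiv ℂ (fderiv ℂ Ψ) w ζ ξ) with hu
    have hu0 : ⟪u, Ψ w⟫_ℂ = 0 := by
      rw [← inner_conj_symm, hu, inner_sub_right, hpr, gramProjection_apply,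
        fderiv_fderiv_eq_sum hU hΨ hw]
      simp only [inner_sum, inner_smul_right, hz1, hz2, mul_zero, Finset.sum_const_zero, sub_zero,
        map_zero]
    have hu1 : ∀ v, ⟪u, fderiv ℂ Ψ w v⟫_ℂ = 0 := by
      intro v
      rw [fderiv_apply_eq_sum_coordDeriv, ← inner_conj_symm]
      simp only [sum_inner, inner_smul_left]
      simp only [hu, horth, mul_zero, Finset.sum_const_zero, map_zero]
    have hsq : ⟪u, fderiv ℂ (fderiv ℂ Ψ) w ζ ξ⟫_ℂ = ⟪u, u⟫_ℂ := by
      have h1 : ⟪u, pr (fderiv ℂ (fderiv ℂ Ψ) w ζ ξ)⟫_ℂ = 0 := by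
        rw [← inner_conj_symm, inner_gramProjection_eq_zero (fun c => horth c _), map_zero]
      conv_rhs => rw [hu, inner_sub_right, ← hu, h1, sub_zero]
    let B : (Fin n → ℂ) →ₗ[ℂ] (Fin n → ℂ) →ₗ[ℂ] ℂ := LinearMap.mk₂ ℂ
      (fun ξ ζ => ⟪u, fderiv ℂ (fderiv ℂ Ψ) w ζ ξ⟫_ℂ)
      (fun a b c => by rw [map_add, inner_add_right])
      (fun c a b => by rw [map_smul, inner_smul_right, smul_eq_mul])
      (fun a b c => by rw [map_add, add_apply, inner_add_right])
      (fun c a b => by rw [map_smul, smul_apply, inner_smul_right, smul_eq_mul])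
    have hB := norm_le_of_norm_self_le (fderiv ℂ Ψ w).toLinearMap hD B
      (fun a b => congrArg (fun v => ⟪u, v⟫_ℂ) (fderiv_fderiv_comm hU hΨ hw a b))
      (c := C * ‖u‖ / ‖Ψ w‖) (fun a => (hC u hu0 hu1 a).trans_eq (by
        simp only [ContinuousLinearMap.coe_coe]
        ring)) ξ ζ
    have hB' : ‖u‖ ^ 2 ≤ C * ‖u‖ / ‖Ψ w‖ * (‖fderiv ℂ Ψ w ξ‖ * ‖fderiv ℂ Ψ w ζ‖) := by
      refine le_of_eq_of_le ?_ hB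
      change _ = ‖⟪u, fderiv ℂ (fderiv ℂ Ψ) w ζ ξ⟫_ℂ‖
      rw [hsq, norm_inner_self_eq_norm_sq]
    rcases (norm_nonneg u).eq_or_lt with h | h
    · rw [← h]
      positivity
    · refine le_of_mul_le_mul_left ?_ h
      calc ‖u‖ * ‖u‖ = ‖u‖ ^ 2 := by ring
        _ ≤ _ := hB'
        _ = _ := by ring
  have hlast : ⟪fderiv ℂ (fderiv ℂ Ψ) w θ η, fderiv ℂ (fderiv ℂ Ψ) w ζ ξ -
        pr (fderiv ℂ (fderiv ℂ Ψ) w ζ ξ)⟫_ℂ =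
      ⟪fderiv ℂ (fderiv ℂ Ψ) w θ η - pr (fderiv ℂ (fderiv ℂ Ψ) w θ η),
        fderiv ℂ (fderiv ℂ Ψ) w ζ ξ - pr (fderiv ℂ (fderiv ℂ Ψ) w ζ ξ)⟫_ℂ := by
    rw [inner_sub_left, inner_gramProjection_eq_zero (fun c => horth c _), sub_zero]
  rw [hlast]
  have h1 := norm_inner_le_norm (𝕜 := ℂ) (fderiv ℂ Ψ w η) (fderiv ℂ Ψ w ξ)
  have h2 := norm_inner_le_norm (𝕜 := ℂ) (fderiv ℂ Ψ w θ) (fderiv ℂ Ψ w ζ)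
  have h3 := norm_inner_le_norm (𝕜 := ℂ) (fderiv ℂ Ψ w η) (fderiv ℂ Ψ w ζ)
  have h4 := norm_inner_le_norm (𝕜 := ℂ) (fderiv ℂ Ψ w θ) (fderiv ℂ Ψ w ξ)
  have h5 := norm_inner_le_norm (𝕜 := ℂ)
    (fderiv ℂ (fderiv ℂ Ψ) w θ η - pr (fderiv ℂ (fderiv ℂ Ψ) w θ η))
    (fderiv ℂ (fderiv ℂ Ψ) w ζ ξ - pr (fderiv ℂ (fderiv ℂ Ψ) w ζ ξ))
  refine (norm_sub_le _ _).trans ?_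
  rw [norm_mul, norm_mul, norm_pow, hMnorm]
  -- The `2` comes from the two Fubini-Study terms, `C ^ 2` from the product of two normal
  -- components.
  calc _ ≤ (‖fderiv ℂ Ψ w η‖ * ‖fderiv ℂ Ψ w ξ‖ * (‖fderiv ℂ Ψ w θ‖ * ‖fderiv ℂ Ψ w ζ‖) +
          ‖fderiv ℂ Ψ w η‖ * ‖fderiv ℂ Ψ w ζ‖ * (‖fderiv ℂ Ψ w θ‖ * ‖fderiv ℂ Ψ w ξ‖)) *
            (‖Ψ w‖ ^ 2)⁻¹ ^ 2 +
          (C / ‖Ψ w‖ * (‖fderiv ℂ Ψ w η‖ * ‖fderiv ℂ Ψ w θ‖)) *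
            (C / ‖Ψ w‖ * (‖fderiv ℂ Ψ w ξ‖ * ‖fderiv ℂ Ψ w ζ‖)) * (‖Ψ w‖ ^ 2)⁻¹ := by
        gcongr
        · refine (norm_add_le _ _).trans ?_
          rw [norm_mul, norm_mul]
          gcongr
        · refine h5.trans ?_
          gcongr
          · exact hV η θ
          · exact hV ξ ζ
    _ = _ := by
        field_simp
        ring

end NormalizedCurvature

/-! ### From conditions on 2-jets of Bergman functions to positivity and bounded curvature. -/

section CurvatureOfMap

open Filter Topology
open scoped InnerProductSpace

variable {n : ℕ} {Ω : Set (Fin n → ℂ)} {w : Fin n → ℂ}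

theorem chernCurvatureForm_congr {g g' : (Fin n → ℂ) → Matrix (Fin n) (Fin n) ℂ}
    (h : g =ᶠ[𝓝 w] g') : chernCurvatureForm g w = chernCurvatureForm g' w := by
  have hij : ∀ i j, (fun z => g z i j) =ᶠ[𝓝 w] fun z => g' z i j := fun i j =>
    h.mono fun z hz => by simp only [hz]
  have hR : chernCurvature g w = chernCurvature g' w := by
    ext i j k l
    simp only [chernCurvature, h.eq_of_nhds, (hij _ _).wirtinger_eq, (hij _ _).wirtingerBar_eq,
      ((hij i j).wirtingerBar l).wirtinger_eq]
  ext ξ η ζ θ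
  simp only [chernCurvatureForm, hR]

theorem hermitianLength_congr {g g' : (Fin n → ℂ) → Matrix (Fin n) (Fin n) ℂ}
    (h : g w = g' w) : hermitianLength g w = hermitianLength g' w := by
  ext ξ
  simp only [hermitianLength, h]

variable {H : Type*} [NormedAddCommGroup H] [InnerProductSpace ℂ H]

theorem fderiv_inner_const_apply {Φ : (Fin n → ℂ) → H} {z : Fin n → ℂ}
    (hΦ : DifferentiableAt ℂ Φ z) (u : H) (v : Fin n → ℂ) :
    fderiv ℂ (fun y => ⟪u, Φ y⟫_ℂ) z v = ⟪u, fderiv ℂ Φ z v⟫_ℂ := by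
  have h : HasFDerivAt (fun y => ⟪u, Φ y⟫_ℂ) ((innerSL ℂ u).comp (fderiv ℂ Φ z)) z :=
    (innerSL ℂ u).hasFDerivAt.comp z hΦ.hasFDerivAt
  rw [h.fderiv]
  rfl

variable [CompleteSpace H]

theorem fderiv_fderiv_apply {F : Type*} [NormedAddCommGroup F] [NormedSpace ℂ F] [CompleteSpace F]
    {Φ : (Fin n → ℂ) → F} (hΩ : IsOpen Ω) (hΦ : DifferentiableOn ℂ Φ Ω) (hw : w ∈ Ω)
    (ξ ζ : Fin n → ℂ) :
    fderiv ℂ (fun z => fderiv ℂ Φ z ξ) w ζ = fderiv ℂ (fderiv ℂ Φ) w ζ ξ := by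
  have h2 : DifferentiableAt ℂ (fderiv ℂ Φ) w :=
    (((hΦ.contDiffOn_of_finiteDimensional hΩ).fderiv_of_isOpen hΩ
      (m := 1) (by norm_cast)).differentiableOn one_ne_zero).differentiableAt (hΩ.mem_nhds hw)
  rw [fderiv_clm_apply h2 (differentiableAt_const _)]
  simp

theorem fderiv_fderiv_inner_const {Φ : (Fin n → ℂ) → H} (hΩ : IsOpen Ω)
    (hΦ : DifferentiableOn ℂ Φ Ω) (hw : w ∈ Ω) (u : H) (ξ : Fin n → ℂ) :
    fderiv ℂ (fderiv ℂ fun y => ⟪u, Φ y⟫_ℂ) w ξ ξ = ⟪u, fderiv ℂ (fderiv ℂ Φ) w ξ ξ⟫_ℂ := by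
  have hd : DifferentiableOn ℂ (fun y => ⟪u, Φ y⟫_ℂ) Ω :=
    (innerSL ℂ u).differentiable.comp_differentiableOn hΦ
  rw [← fderiv_fderiv_apply hΩ hd hw, ← fderiv_fderiv_apply hΩ hΦ hw]
  have he : (fun z => fderiv ℂ (fun y => ⟪u, Φ y⟫_ℂ) z ξ) =ᶠ[𝓝 w]
      fun z => ⟪u, fderiv ℂ Φ z ξ⟫_ℂ := by
    filter_upwards [hΩ.mem_nhds hw] with z hz
    exact fderiv_inner_const_apply (hΦ.differentiableAt (hΩ.mem_nhds hz)) u ξ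
  rw [he.fderiv_eq, fderiv_inner_const_apply
    ((hΦ.fderiv_apply_of_isOpen hΩ ξ).differentiableAt (hΩ.mem_nhds hw))]

/-- Positivity and curvature bound for the pullback metric of a map to a Hilbert space, from
conditions on the functions `⟪u, Φ ·⟫`. -/
theorem posDef_and_curvature_le_of_jets {Φ : (Fin n → ℂ) → H} (hΩ : IsOpen Ω)
    (hΦ : DifferentiableOn ℂ Φ Ω) (hw : w ∈ Ω) (h0 : Φ w ≠ 0)
    (hD : ∀ ξ, ξ ≠ 0 → ∃ u, ⟪u, Φ w⟫_ℂ = 0 ∧ ⟪u, fderiv ℂ Φ w ξ⟫_ℂ ≠ 0) {C : ℝ} (hC0 : 0 ≤ C)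
    (hC : ∀ u, ⟪u, Φ w⟫_ℂ = 0 → (∀ v, ⟪u, fderiv ℂ Φ w v⟫_ℂ = 0) → ∀ ξ,
      ∃ v, ‖v‖ ≤ 1 ∧ ⟪v, Φ w⟫_ℂ = 0 ∧
        ‖⟪u, fderiv ℂ (fderiv ℂ Φ) w ξ ξ⟫_ℂ‖ * ‖Φ w‖ ≤ C * ‖u‖ * ‖⟪v, fderiv ℂ Φ w ξ⟫_ℂ‖ ^ 2) :
    (fubiniStudyPullback Φ w).PosDef ∧ ∀ ξ η ζ θ,
      ‖chernCurvatureForm (fubiniStudyPullback Φ) w ξ η ζ θ‖ ≤ (2 + C ^ 2) *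
        (hermitianLength (fubiniStudyPullback Φ) w ξ * hermitianLength (fubiniStudyPullback Φ) w η *
          hermitianLength (fubiniStudyPullback Φ) w ζ *
          hermitianLength (fubiniStudyPullback Φ) w θ) := by
  -- The gauge making `⟪Φ w, φ z • Φ z⟫` constant in `z`, with `φ w = 1`; it exists where `⟪Φ w, Φ
  -- z⟫ ≠ 0`, which includes a neighbourhood of `w`.
  set φ : (Fin n → ℂ) → ℂ := fun z => ⟪Φ w, Φ w⟫_ℂ * (⟪Φ w, Φ z⟫_ℂ)⁻¹ with hφdef
  set U : Set (Fin n → ℂ) := Ω ∩ (fun z => ⟪Φ w, Φ z⟫_ℂ) ⁻¹' {0}ᶜ with hUdef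
  have hN : ⟪Φ w, Φ w⟫_ℂ ≠ 0 := inner_self_ne_zero.mpr h0
  have hin : DifferentiableOn ℂ (fun y => ⟪Φ w, Φ y⟫_ℂ) Ω :=
    (innerSL ℂ (Φ w)).differentiable.comp_differentiableOn hΦ
  have hU : IsOpen U := hin.continuousOn.isOpen_inter_preimage hΩ isOpen_compl_singleton
  have hwU : w ∈ U := ⟨hw, hN⟩
  have hφ : DifferentiableOn ℂ φ U :=
    ((hin.mono Set.inter_subset_left).fun_inv fun z (hz : z ∈ U) => hz.2).const_mul _
  have hφw : φ w = 1 := mul_inv_cancel₀ hN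
  have hφ0 : ∀ z ∈ U, φ z ≠ 0 := fun z hz => mul_ne_zero hN (inv_ne_zero hz.2)
  have hΦU : DifferentiableOn ℂ Φ U := hΦ.mono Set.inter_subset_left
  have hΦ0 : ∀ z ∈ U, Φ z ≠ 0 := fun z hz h => hz.2 (by simp [h])
  set Ψ : (Fin n → ℂ) → H := fun z => φ z • Φ z with hΨdef
  have hΨ : DifferentiableOn ℂ Ψ U := hφ.smul hΦU
  have hΨ0 : ∀ z ∈ U, Ψ z ≠ 0 := fun z hz => smul_ne_zero (hφ0 z hz) (hΦ0 z hz)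
  have hΨw : Ψ w = Φ w := by simp [hΨdef, hφw]
  have hc : ∀ z ∈ U, ⟪Ψ w, Ψ z⟫_ℂ = ⟪Ψ w, Ψ w⟫_ℂ := by
    intro z hz
    rw [hΨw]
    simp only [hΨdef, inner_smul_right, hφdef]
    exact inv_mul_cancel_right₀ hz.2 _
  have hda : ∀ z ∈ U, DifferentiableAt ℂ φ z ∧ DifferentiableAt ℂ Φ z := fun z hz =>
    ⟨hφ.differentiableAt (hU.mem_nhds hz), hΦU.differentiableAt (hU.mem_nhds hz)⟩
  have hg : fubiniStudyPullback Φ =ᶠ[𝓝 w] fubiniStudyPullback Ψ := by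
    filter_upwards [hU.mem_nhds hwU] with z hz
    exact (fubiniStudyPullback_smul (hda z hz).2 (hda z hz).1 (hΦ0 z hz) (hφ0 z hz)).symm
  have hd1 : ∀ z ∈ U, ∀ ξ, fderiv ℂ Ψ z ξ = φ z • fderiv ℂ Φ z ξ + fderiv ℂ φ z ξ • Φ z := by
    intro z hz ξ
    rw [hΨdef, fderiv_fun_smul (hda z hz).1 (hda z hz).2]
    rfl
  -- The gauge adds only multiples of lower order jets, which `u` annihilates, so the hypotheses on
  -- `Φ` transfer to `Ψ`.
  have hin1 : ∀ u, ⟪u, Φ w⟫_ℂ = 0 → ∀ ξ, ⟪u, fderiv ℂ Ψ w ξ⟫_ℂ = ⟪u, fderiv ℂ Φ w ξ⟫_ℂ := by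
    intro u hu ξ
    rw [hd1 w hwU, inner_add_right, inner_smul_right, inner_smul_right, hu, hφw]
    ring
  have hin2 : ∀ u, ⟪u, Φ w⟫_ℂ = 0 → (∀ v, ⟪u, fderiv ℂ Φ w v⟫_ℂ = 0) → ∀ ξ,
      ⟪u, fderiv ℂ (fderiv ℂ Ψ) w ξ ξ⟫_ℂ = ⟪u, fderiv ℂ (fderiv ℂ Φ) w ξ ξ⟫_ℂ := by
    intro u hu hu1 ξ
    rw [← fderiv_fderiv_apply hU hΨ hwU, ← fderiv_fderiv_apply hU hΦU hwU]
    have he : (fun z => fderiv ℂ Ψ z ξ) =ᶠ[𝓝 w]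
        fun z => φ z • fderiv ℂ Φ z ξ + fderiv ℂ φ z ξ • Φ z := by
      filter_upwards [hU.mem_nhds hwU] with z hz using hd1 z hz ξ
    have hΦξ := (hΦU.fderiv_apply_of_isOpen hU ξ).differentiableAt (hU.mem_nhds hwU)
    have hφξ := (hφ.fderiv_apply_of_isOpen hU ξ).differentiableAt (hU.mem_nhds hwU)
    obtain ⟨hφd, hΦd⟩ := hda w hwU
    rw [he.fderiv_eq, fderiv_fun_add (hφd.fun_smul hΦξ) (hφξ.fun_smul hΦd), fderiv_fun_smul hφd hΦξ,
      fderiv_fun_smul hφξ hΦd]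
    simp only [add_apply, smul_apply, ContinuousLinearMap.smulRight_apply, inner_add_right,
      inner_smul_right, hu, hu1, hφw]
    ring
  have hDΨ : ∀ ξ, fderiv ℂ Ψ w ξ = 0 → ξ = 0 := by
    intro ξ hξ
    by_contra hne
    obtain ⟨u, hu, hu'⟩ := hD ξ hne
    apply hu'
    rw [← hin1 u hu, hξ, inner_zero_right]
  refine ⟨?_, ?_⟩
  · rw [hg.eq_of_nhds]
    exact posDef_fubiniStudyPullback (fun i => inner_coordDeriv_eq_zero hU hΨ hc hwU i)
      (hΨ0 w hwU) hDΨ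
  · rw [chernCurvatureForm_congr hg, hermitianLength_congr hg.eq_of_nhds]
    refine norm_chernCurvatureForm_fubiniStudyPullback_le hU hΨ hwU hΨ0 hc hDΨ hC0 ?_
    intro u hu hu1 ξ
    rw [hΨw] at hu
    have hu1' : ∀ v, ⟪u, fderiv ℂ Φ w v⟫_ℂ = 0 := fun v => by rw [← hin1 u hu, hu1]
    obtain ⟨v, hv1, hv0, hv⟩ := hC u hu hu1' ξ
    rw [hin2 u hu hu1' ξ, hΨw, le_div_iff₀ (norm_pos_iff.mpr h0)]
    refine hv.trans ?_
    have h1 : ‖⟪v, fderiv ℂ Φ w ξ⟫_ℂ‖ ≤ ‖fderiv ℂ Ψ w ξ‖ := by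
      rw [← hin1 v hv0]
      refine (norm_inner_le_norm _ _).trans ?_
      exact mul_le_of_le_one_left (norm_nonneg _) hv1
    gcongr

/-- Vectors `u` and Bergman functions `⟪u, Φ ·⟫` correspond with equal norms, so the conditions on
jets of functions become the conditions on `Φ` in `posDef_and_curvature_le_of_jets`. -/
theorem bergman_boundedCurvature_of_jets_of_map (hΩ : IsOpen Ω)
    {Φ : (Fin n → ℂ) → H} (hΦ : DifferentiableOn ℂ Φ Ω)
    (hK : ∀ z ∈ Ω, bergmanKernel Ω z z = ⟪Φ z, Φ z⟫_ℂ)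
    (hF1 : ∀ u : H, ∃ f : bergmanSpace Ω, ‖f‖ = ‖u‖ ∧
      ∀ z ∈ Ω, ⟪u, Φ z⟫_ℂ = bergmanSpace.toFun f z)
    (hF2 : ∀ f : bergmanSpace Ω, ∃ u : H, ‖u‖ = ‖f‖ ∧
      ∀ z ∈ Ω, ⟪u, Φ z⟫_ℂ = bergmanSpace.toFun f z)
    (hpos : ∀ w ∈ Ω, ∃ f : bergmanSpace Ω, bergmanSpace.toFun f w ≠ 0)
    (hD : ∀ w ∈ Ω, ∀ ξ, ξ ≠ 0 → ∃ f : bergmanSpace Ω, bergmanSpace.toFun f w = 0 ∧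
      fderiv ℂ (bergmanSpace.toFun f) w ξ ≠ 0) {C : ℝ} (hC0 : 0 ≤ C)
    (hC : ∀ w ∈ Ω, ∀ f : bergmanSpace Ω, bergmanSpace.toFun f w = 0 →
      fderiv ℂ (bergmanSpace.toFun f) w = 0 → ∀ ξ, ∃ h : bergmanSpace Ω, ‖h‖ ≤ 1 ∧
        bergmanSpace.toFun h w = 0 ∧ ∀ k : bergmanSpace Ω, ‖k‖ ≤ 1 →
          ‖fderiv ℂ (fderiv ℂ (bergmanSpace.toFun f)) w ξ ξ‖ * ‖bergmanSpace.toFun k w‖ ≤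
            C * ‖f‖ * ‖fderiv ℂ (bergmanSpace.toFun h) w ξ‖ ^ 2) :
    (∀ z ∈ Ω, 0 < (bergmanKernel Ω z z).re) ∧ ContDiffOn ℝ ∞ (logBergmanKernel Ω) Ω ∧
      (∀ z ∈ Ω, (bergmanMetric Ω z).PosDef) ∧ HasBoundedCurvature (bergmanMetric Ω) Ω := by
  have h0 : ∀ w ∈ Ω, Φ w ≠ 0 := by
    intro w hw hΦw
    obtain ⟨f, hf⟩ := hpos w hw
    obtain ⟨u, -, hu⟩ := hF2 f
    rw [← hu w hw, hΦw, inner_zero_right] at hf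
    exact hf rfl
  have hKpos : ∀ z ∈ Ω, 0 < (bergmanKernel Ω z z).re := by
    intro z hz
    have hpos : 0 < ‖Φ z‖ ^ 2 := by
      have := norm_pos_iff.mpr (h0 z hz)
      positivity
    rw [hK z hz, inner_self_eq_norm_sq_to_K]
    refine hpos.trans_eq ?_
    rw [RCLike.ofReal_eq_complex_ofReal, ← Complex.ofReal_pow, Complex.ofReal_re]
  have hlog : ∀ z ∈ Ω, logBergmanKernel Ω z = Real.log (⟪Φ z, Φ z⟫_ℂ).re := fun z hz => by
    rw [logBergmanKernel, hK z hz]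
  have hg : ∀ z ∈ Ω, bergmanMetric Ω z = fubiniStudyPullback Φ z := by
    intro z hz
    ext i j
    rw [← wirtinger_wirtingerBar_log_inner hΩ hΦ h0 hz]
    have he : (fun w => (logBergmanKernel Ω w : ℂ)) =ᶠ[𝓝 z]
        fun w => (Real.log (⟪Φ w, Φ w⟫_ℂ).re : ℂ) := by
      filter_upwards [hΩ.mem_nhds hz] with y hy
      rw [hlog y hy]
    exact (he.wirtingerBar j).wirtinger_eq i
  have hfd : ∀ z ∈ Ω, ∀ u (f : bergmanSpace Ω),
      (∀ z ∈ Ω, ⟪u, Φ z⟫_ℂ = bergmanSpace.toFun f z) →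
      (∀ ξ, ⟪u, fderiv ℂ Φ z ξ⟫_ℂ = fderiv ℂ (bergmanSpace.toFun f) z ξ) ∧
      ∀ ξ, ⟪u, fderiv ℂ (fderiv ℂ Φ) z ξ ξ⟫_ℂ =
        fderiv ℂ (fderiv ℂ (bergmanSpace.toFun f)) z ξ ξ := by
    intro z hz u f huf
    have he : (fun y => ⟪u, Φ y⟫_ℂ) =ᶠ[𝓝 z] bergmanSpace.toFun f := by
      filter_upwards [hΩ.mem_nhds hz] with y hy using huf y hy
    refine ⟨fun ξ => ?_, fun ξ => ?_⟩
    · rw [← he.fderiv_eq, fderiv_inner_const_apply (hΦ.differentiableAt (hΩ.mem_nhds hz))]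
    · rw [← he.fderiv.fderiv_eq, fderiv_fderiv_inner_const hΩ hΦ hz]
  have hmain : ∀ w ∈ Ω, _ := fun w hw =>
    posDef_and_curvature_le_of_jets (C := C) hΩ hΦ hw (h0 w hw) (fun ξ hξ => by
      obtain ⟨f, hf0, hf1⟩ := hD w hw ξ hξ
      obtain ⟨u, -, hu⟩ := hF2 f
      refine ⟨u, by rw [hu w hw, hf0], ?_⟩
      rwa [(hfd w hw u f hu).1]) hC0 (fun u hu0 hu1 ξ => by
      obtain ⟨f, hfn, hf⟩ := hF1 u
      obtain ⟨h, hh1, hh0, hh⟩ := hC w hw f (by rw [← hf w hw, hu0])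
        (by ext v; rw [← (hfd w hw u f hf).1, hu1, zero_apply]) ξ
      obtain ⟨v, hvn, hv⟩ := hF2 h
      refine ⟨v, hvn.trans_le hh1, by rw [hv w hw, hh0], ?_⟩
      -- The extremal function for evaluation at `w`: it has norm one and `|k w| = ‖Φ w‖`, so the
      -- bound for all `k` in the unit ball gives the factor `‖Φ w‖`.
      obtain ⟨k, hkn, hk⟩ := hF1 ((‖Φ w‖ : ℂ)⁻¹ • Φ w)
      have hΦpos := norm_pos_iff.mpr (h0 w hw)
      have hk1 : ‖k‖ ≤ 1 := by
        rw [hkn, norm_smul, norm_inv, Complex.norm_real, norm_norm, inv_mul_cancel₀ hΦpos.ne']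
      have hkw : ‖bergmanSpace.toFun k w‖ = ‖Φ w‖ := by
        rw [← hk w hw, inner_smul_left, norm_mul, norm_inner_self_eq_norm_sq, RCLike.norm_conj,
          norm_inv, Complex.norm_real, norm_norm]
        field_simp
      have := hh k hk1
      rwa [hkw, hfn, ← (hfd w hw u f hf).2, ← (hfd w hw v h hv).1] at this)
  refine ⟨hKpos, ?_, fun z hz => ?_, 2 + C ^ 2, fun z hz ξ η ζ θ => ?_⟩
  · have hΦR : ContDiffOn ℝ ∞ Φ Ω := (hΦ.contDiffOn_of_finiteDimensional hΩ).restrict_scalars ℝ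
    have hre : ContDiffOn ℝ ∞ (fun z => (⟪Φ z, Φ z⟫_ℂ).re) Ω :=
      Complex.reCLM.contDiff.comp_contDiffOn (hΦR.inner ℂ hΦR)
    refine (hre.log fun z hz => ?_).congr hlog
    rw [← hK z hz]
    exact (hKpos z hz).ne'
  · rw [hg z hz]
    exact (hmain z hz).1
  · have he : bergmanMetric Ω =ᶠ[𝓝 z] fubiniStudyPullback Φ := by
      filter_upwards [hΩ.mem_nhds hz] with y hy using hg y hy
    rw [chernCurvatureForm_congr he, hermitianLength_congr he.eq_of_nhds]
    exact (hmain z hz).2 ξ η ζ θ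

/-- A criterion for the Bergman kernel to be positive, the Bergman metric to be positive definite,
and its curvature to be bounded, in terms of the `2`-jets of functions of the Bergman space. -/
theorem bergman_boundedCurvature_of_jets (hΩ : IsOpen Ω)
    (hpos : ∀ w ∈ Ω, ∃ f : bergmanSpace Ω, bergmanSpace.toFun f w ≠ 0)
    (hD : ∀ w ∈ Ω, ∀ ξ, ξ ≠ 0 → ∃ f : bergmanSpace Ω, bergmanSpace.toFun f w = 0 ∧
      fderiv ℂ (bergmanSpace.toFun f) w ξ ≠ 0) {C : ℝ} (hC0 : 0 ≤ C)
    (hC : ∀ w ∈ Ω, ∀ f : bergmanSpace Ω, bergmanSpace.toFun f w = 0 →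
      fderiv ℂ (bergmanSpace.toFun f) w = 0 → ∀ ξ, ∃ h : bergmanSpace Ω, ‖h‖ ≤ 1 ∧
        bergmanSpace.toFun h w = 0 ∧ ∀ k : bergmanSpace Ω, ‖k‖ ≤ 1 →
          ‖fderiv ℂ (fderiv ℂ (bergmanSpace.toFun f)) w ξ ξ‖ * ‖bergmanSpace.toFun k w‖ ≤
            C * ‖f‖ * ‖fderiv ℂ (bergmanSpace.toFun h) w ξ‖ ^ 2) :
    (∀ z ∈ Ω, 0 < (bergmanKernel Ω z z).re) ∧ ContDiffOn ℝ ∞ (logBergmanKernel Ω) Ω ∧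
      (∀ z ∈ Ω, (bergmanMetric Ω z).PosDef) ∧ HasBoundedCurvature (bergmanMetric Ω) Ω :=
  (exists_bergman_map hΩ).elim fun _ h =>
    bergman_boundedCurvature_of_jets_of_map hΩ h.1 h.2.1 h.2.2.1 h.2.2.2 hpos hD hC0 hC

end CurvatureOfMap

/-! ### Uniform squeezing between polydiscs implies bounded curvature. -/

section Squeezing

open Metric Filter Topology
open scoped ENNReal

variable {n : ℕ} {Ω : Set (Fin n → ℂ)}

/-- The holomorphic Jacobian determinant of a map `ℂⁿ → ℂⁿ`. -/
noncomputable def complexJacobian (Γ : (Fin n → ℂ) → Fin n → ℂ) (z : Fin n → ℂ) : ℂ :=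
  (fderiv ℂ Γ z).det

theorem differentiableOn_complexJacobian {Γ : (Fin n → ℂ) → Fin n → ℂ} (hΩ : IsOpen Ω)
    (hΓ : DifferentiableOn ℂ Γ Ω) : DifferentiableOn ℂ (complexJacobian Γ) Ω := by
  -- The Leibniz expansion exhibits the determinant as a polynomial in holomorphic directional
  -- derivatives.
  have h : complexJacobian Γ = fun z => ∑ σ : Equiv.Perm (Fin n), (Equiv.Perm.sign σ : ℂ) *
      ∏ i, fderiv ℂ Γ z (Pi.single i 1) (σ i) := by
    ext z
    rw [complexJacobian, ContinuousLinearMap.det, ← LinearMap.det_toMatrix', Matrix.det_apply]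
    refine Finset.sum_congr rfl fun σ _ => ?_
    rw [Units.smul_def, zsmul_eq_mul]
    simp [LinearMap.toMatrix'_apply]
  rw [h]
  refine DifferentiableOn.fun_sum fun σ _ => DifferentiableOn.const_mul ?_ _
  have hp : ContDiffOn ℂ ∞ (fun z => ∏ i, fderiv ℂ Γ z (Pi.single i 1) (σ i)) Ω :=
    contDiffOn_prod fun i _ => (differentiableOn_pi.mp
      (hΓ.fderiv_apply_of_isOpen hΩ (Pi.single i 1)) (σ i)).contDiffOn_of_finiteDimensional hΩ
  exact hp.differentiableOn (by simp)

/-- Change of variables for an injective holomorphic map. -/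
theorem lintegral_image_eq_lintegral_complexJacobian {Γ : (Fin n → ℂ) → Fin n → ℂ}
    (hΩ : IsOpen Ω) (hΓ : DifferentiableOn ℂ Γ Ω) (hinj : Set.InjOn Γ Ω)
    (g : (Fin n → ℂ) → ℝ≥0∞) :
    ∫⁻ w in Γ '' Ω, g w = ∫⁻ z in Ω, ‖complexJacobian Γ z‖ₑ ^ 2 * g (Γ z) := by
  rw [lintegral_image_eq_lintegral_abs_det_fderiv_mul volume hΩ.measurableSet (fun z hz =>
    ((hΓ.differentiableAt (hΩ.mem_nhds hz)).hasFDerivAt.restrictScalars ℝ).hasFDerivWithinAt) hinj]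
  refine lintegral_congr fun z => ?_
  congr 1
  have h : ((fderiv ℂ Γ z).restrictScalars ℝ).det = ‖complexJacobian Γ z‖ ^ 2 := by
    have h1 : ((fderiv ℂ Γ z).restrictScalars ℝ).det =
        LinearMap.det ((fderiv ℂ Γ z).toLinearMap.restrictScalars ℝ) := rfl
    rw [h1, LinearMap.det_restrictScalars, Algebra.norm_complex_eq, complexJacobian,
      ← Complex.normSq_eq_norm_sq]
    rfl
  rw [h, abs_of_nonneg (by positivity), ENNReal.ofReal_pow (norm_nonneg _), ofReal_norm]

/-- Pulling back a bounded holomorphic function on `ball 0 R` by an injective holomorphic map, with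
the Jacobian factor, gives an element of the Bergman space of controlled norm. -/
theorem exists_bergmanSpace_comp_mul_jacobian (n : ℕ) {R B : ℝ} (hR : 0 < R) (hB : 0 < B) :
    ∃ M : ℝ, 0 < M ∧ ∀ (Ω : Set (Fin n → ℂ)) (Γ : (Fin n → ℂ) → Fin n → ℂ)
      (h : (Fin n → ℂ) → ℂ), IsOpen Ω → DifferentiableOn ℂ Γ Ω → Set.InjOn Γ Ω →
      Set.MapsTo Γ Ω (ball 0 R) → DifferentiableOn ℂ h (ball 0 R) →
      (∀ u ∈ ball 0 R, ‖h u‖ ≤ B) → ∃ f : bergmanSpace Ω, ‖f‖ ≤ M ∧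
        Set.EqOn (bergmanSpace.toFun f) (fun z => h (Γ z) * complexJacobian Γ z) Ω := by
  have hV0 : 0 < volume (ball (0 : Fin n → ℂ) R) := measure_ball_pos _ _ hR
  have hVt : volume (ball (0 : Fin n → ℂ) R) ≠ ⊤ := measure_ball_lt_top.ne
  set V := (volume (ball (0 : Fin n → ℂ) R)).toReal with hV
  have hVpos : 0 < V := ENNReal.toReal_pos hV0.ne' hVt
  -- The norm bound involves only the bound on `h` and the volume of the target polydisc, since
  -- `|complexJacobian Γ|²` is the real Jacobian; this is the source of uniformity in `Ω` and `Γ`.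
  refine ⟨B * √V, by positivity, fun Ω Γ h hΩ hΓ hinj hmaps hh hb => ?_⟩
  refine exists_bergmanSpace_toFun_eqOn hΩ
    ((hh.comp hΓ hmaps).mul (differentiableOn_complexJacobian hΩ hΓ)) (by positivity) ?_
  calc ∫⁻ z in Ω, ‖h (Γ z) * complexJacobian Γ z‖ₑ ^ 2
      = ∫⁻ z in Ω, ‖complexJacobian Γ z‖ₑ ^ 2 * ‖h (Γ z)‖ₑ ^ 2 := by
        refine lintegral_congr fun z => ?_
        rw [enorm_mul, mul_pow, mul_comm]
    _ = ∫⁻ u in Γ '' Ω, ‖h u‖ₑ ^ 2 :=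
        (lintegral_image_eq_lintegral_complexJacobian hΩ hΓ hinj fun u => ‖h u‖ₑ ^ 2).symm
    _ ≤ ∫⁻ u in ball 0 R, ‖h u‖ₑ ^ 2 := lintegral_mono_set hmaps.image_subset
    _ ≤ ∫⁻ _ in ball (0 : Fin n → ℂ) R, ENNReal.ofReal (B ^ 2) := by
        refine setLIntegral_mono' measurableSet_ball fun u hu => ?_
        rw [← ofReal_norm, ← ENNReal.ofReal_pow (norm_nonneg _)]
        exact ENNReal.ofReal_le_ofReal (by gcongr; exact hb u hu)
    _ = ENNReal.ofReal ((B * √V) ^ 2) := by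
        rw [setLIntegral_const, ← ENNReal.ofReal_toReal hVt, ← hV, ← ENNReal.ofReal_mul
          (by positivity), mul_pow, Real.sq_sqrt hVpos.le]

/-- Upper bound for functions of the Bergman space in the coordinates given by an injective
holomorphic map from a polydisc. -/
theorem exists_norm_comp_mul_jacobian_le (n : ℕ) {r : ℝ} (hr : 0 < r) :
    ∃ C : ℝ, 0 < C ∧ ∀ (Ω : Set (Fin n → ℂ)) (G : (Fin n → ℂ) → Fin n → ℂ) (f : bergmanSpace Ω),
      DifferentiableOn ℂ G (ball 0 r) → Set.InjOn G (ball 0 r) → Set.MapsTo G (ball 0 r) Ω →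
      DifferentiableOn ℂ (fun u => complexJacobian G u * bergmanSpace.toFun f (G u)) (ball 0 r) ∧
      ∀ u ∈ ball (0 : Fin n → ℂ) (r / 2),
        ‖complexJacobian G u * bergmanSpace.toFun f (G u)‖ ≤ C * ‖f‖ := by
  obtain ⟨C, hC, h⟩ := exists_norm_le_mul_of_setLIntegral_le n hr
  refine ⟨C, hC, fun Ω G f hG hinj hmaps => ?_⟩
  have hd := (differentiableOn_complexJacobian isOpen_ball hG).fun_mul
    ((bergmanSpace.differentiableOn_toFun f).comp hG hmaps)
  refine ⟨hd, h _ 0 ‖f‖ hd (norm_nonneg _) ?_⟩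
  calc _ = ∫⁻ u in ball 0 r, ‖complexJacobian G u‖ₑ ^ 2 * ‖bergmanSpace.toFun f (G u)‖ₑ ^ 2 := by
        refine lintegral_congr fun u => ?_
        rw [enorm_mul, mul_pow]
    _ = ∫⁻ z in G '' ball 0 r, ‖bergmanSpace.toFun f z‖ₑ ^ 2 :=
        (lintegral_image_eq_lintegral_complexJacobian isOpen_ball hG hinj
          fun z => ‖bergmanSpace.toFun f z‖ₑ ^ 2).symm
    _ ≤ ∫⁻ z in Ω, ‖bergmanSpace.toFun f z‖ₑ ^ 2 := lintegral_mono_set hmaps.image_subset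
    _ = _ := bergmanSpace.lintegral_toFun f

/-- Cauchy's estimate applied twice, each time giving up half of the radius: each application
contributes a factor `4 / R`. -/
theorem norm_fderiv_fderiv_le {f : (Fin n → ℂ) → ℂ} {c : Fin n → ℂ} {R C : ℝ}
    (hd : DifferentiableOn ℂ f (ball c R)) (hC : ∀ z ∈ ball c R, ‖f z‖ ≤ C) (hR : 0 < R)
    (u v : Fin n → ℂ) : ‖fderiv ℂ (fderiv ℂ f) c u v‖ ≤ 16 * C / R ^ 2 * ‖u‖ * ‖v‖ := by
  have hsub : ∀ z ∈ ball c (R / 2), ball z (R / 2) ⊆ ball c R := fun z hz =>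
    ball_subset_ball' (by linarith [mem_ball.mp hz])
  have h1 : ∀ z ∈ ball c (R / 2), ‖fderiv ℂ f z‖ ≤ 2 * C / (R / 2) := fun z hz =>
    norm_fderiv_le_of_norm_le_on_ball (hd.mono (hsub z hz)) (fun y hy => hC y (hsub z hz hy))
      (by positivity)
  have hd2 : DifferentiableOn ℂ (fderiv ℂ f) (ball c R) :=
    ((hd.contDiffOn_of_finiteDimensional isOpen_ball).fderiv_of_isOpen isOpen_ball
      (m := 1) (by norm_cast)).differentiableOn one_ne_zero
  have h2 := norm_fderiv_le_of_norm_le_on_ball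
    (hd2.mono (ball_subset_ball (by linarith : R / 2 ≤ R))) h1 (by positivity)
  refine (ContinuousLinearMap.le_opNorm₂ _ u v).trans ?_
  gcongr
  refine h2.trans (le_of_eq ?_)
  field_simp
  ring

/-- The second derivative of `J * (f ∘ G)` at a point where `f` vanishes to second order. -/
theorem fderiv_fderiv_mul_comp {J f : (Fin n → ℂ) → ℂ} {G : (Fin n → ℂ) → Fin n → ℂ}
    {U : Set (Fin n → ℂ)} {c : Fin n → ℂ} (hU : IsOpen U) (hΩ : IsOpen Ω) (hc : c ∈ U)
    (hJ : DifferentiableOn ℂ J U) (hG : DifferentiableOn ℂ G U) (hmaps : Set.MapsTo G U Ω)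
    (hf : DifferentiableOn ℂ f Ω) (h0 : f (G c) = 0) (h1 : fderiv ℂ f (G c) = 0)
    (u : Fin n → ℂ) :
    fderiv ℂ (fderiv ℂ fun z => J z * f (G z)) c u u =
      J c * fderiv ℂ (fderiv ℂ f) (G c) (fderiv ℂ G c u) (fderiv ℂ G c u) := by
  have hb : DifferentiableOn ℂ (fun z => f (G z)) U := hf.comp hG hmaps
  have hda : ∀ z ∈ U, DifferentiableAt ℂ J z ∧ DifferentiableAt ℂ (fun z => f (G z)) z ∧
      DifferentiableAt ℂ G z ∧ DifferentiableAt ℂ f (G z) := fun z hz =>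
    ⟨hJ.differentiableAt (hU.mem_nhds hz), hb.differentiableAt (hU.mem_nhds hz),
      hG.differentiableAt (hU.mem_nhds hz), hf.differentiableAt (hΩ.mem_nhds (hmaps hz))⟩
  have hb1 : ∀ z ∈ U, fderiv ℂ (fun z => f (G z)) z u = fderiv ℂ f (G z) (fderiv ℂ G z u) := by
    intro z hz
    have := (hda z hz).2.2.2.hasFDerivAt.comp z (hda z hz).2.2.1.hasFDerivAt
    exact congrArg (fun L => L u) this.fderiv
  have hf2 : DifferentiableAt ℂ (fderiv ℂ f) (G c) :=
    (((hf.contDiffOn_of_finiteDimensional hΩ).fderiv_of_isOpen hΩ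
      (m := 1) (by norm_cast)).differentiableOn one_ne_zero).differentiableAt
        (hΩ.mem_nhds (hmaps hc))
  have hGu : DifferentiableAt ℂ (fun z => fderiv ℂ G z u) c :=
    (hG.fderiv_apply_of_isOpen hU u).differentiableAt (hU.mem_nhds hc)
  have hb2 : fderiv ℂ (fun z => fderiv ℂ (fun z => f (G z)) z u) c u =
      fderiv ℂ (fderiv ℂ f) (G c) (fderiv ℂ G c u) (fderiv ℂ G c u) := by
    have he : (fun z => fderiv ℂ (fun z => f (G z)) z u) =ᶠ[𝓝 c]
        fun z => fderiv ℂ f (G z) (fderiv ℂ G z u) := by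
      filter_upwards [hU.mem_nhds hc] with z hz using hb1 z hz
    have h := (hf2.hasFDerivAt.comp c (hda c hc).2.2.1.hasFDerivAt).clm_apply hGu.hasFDerivAt
    rw [he.fderiv_eq]
    refine (congrArg (fun L => L u) h.fderiv).trans ?_
    -- The term with the second derivative of `G` carries the factor `fderiv ℂ f (G c) = 0`.
    simp [h1]
  have hprod : DifferentiableOn ℂ (fun z => J z * f (G z)) U := hJ.mul hb
  rw [← fderiv_fderiv_apply hU hprod hc]
  have he : (fun z => fderiv ℂ (fun z => J z * f (G z)) z u) =ᶠ[𝓝 c]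
      fun z => J z * fderiv ℂ (fun z => f (G z)) z u + f (G z) * fderiv ℂ J z u := by
    filter_upwards [hU.mem_nhds hc] with z hz
    rw [fderiv_fun_mul (hda z hz).1 (hda z hz).2.1]
    rfl
  have hbu := (hb.fderiv_apply_of_isOpen hU u).differentiableAt (hU.mem_nhds hc)
  have hJu := (hJ.fderiv_apply_of_isOpen hU u).differentiableAt (hU.mem_nhds hc)
  obtain ⟨hJd, hbd, -⟩ := hda c hc
  rw [he.fderiv_eq, fderiv_fun_add (hJd.fun_mul hbu) (hbd.fun_mul hJu), fderiv_fun_mul hJd hbu,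
    fderiv_fun_mul hbd hJu]
  simp only [add_apply, smul_apply, smul_eq_mul, hb2, hb1 c hc, h0, h1, zero_apply]
  ring

/-- `Ω` is uniformly squeezed between polydiscs: at every point it has holomorphic coordinates
centered at the point whose image contains the polydisc of radius `r` and lies in the polydisc of
radius `R`. -/
def HasUniformSqueezing (Ω : Set (Fin n → ℂ)) (r R : ℝ) : Prop :=
  ∀ w ∈ Ω, ∃ Γ G : (Fin n → ℂ) → Fin n → ℂ, DifferentiableOn ℂ Γ Ω ∧ Set.InjOn Γ Ω ∧
    Set.MapsTo Γ Ω (ball 0 R) ∧ Γ w = 0 ∧ DifferentiableOn ℂ G (ball 0 r) ∧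
    Set.MapsTo G (ball 0 r) Ω ∧ ∀ u ∈ ball 0 r, Γ (G u) = u

/-- The Bergman metric of a uniformly squeezed domain has bounded curvature. -/
theorem HasUniformSqueezing.bergman_boundedCurvature {r R : ℝ} (hΩ : IsOpen Ω) (hr : 0 < r)
    (hR : 0 < R) (hsq : HasUniformSqueezing Ω r R) :
    (∀ z ∈ Ω, 0 < (bergmanKernel Ω z z).re) ∧ ContDiffOn ℝ ∞ (logBergmanKernel Ω) Ω ∧
      (∀ z ∈ Ω, (bergmanMetric Ω z).PosDef) ∧ HasBoundedCurvature (bergmanMetric Ω) Ω := by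
  -- Two families of test functions: the constant `1`, for positivity of the kernel, and the
  -- coordinate functions, bounded by `R`, for first derivatives.
  obtain ⟨M₁, -, hlow1⟩ := exists_bergmanSpace_comp_mul_jacobian n hR one_pos
  obtain ⟨M, hM, hlow⟩ := exists_bergmanSpace_comp_mul_jacobian n hR hR
  obtain ⟨C, hC, hup⟩ := exists_norm_comp_mul_jacobian_le n hr
  have hcoord : ∀ w ∈ Ω, ∃ Γ G : (Fin n → ℂ) → Fin n → ℂ, DifferentiableOn ℂ Γ Ω ∧
      Set.InjOn Γ Ω ∧ Set.MapsTo Γ Ω (ball 0 R) ∧ Γ w = 0 ∧ DifferentiableOn ℂ G (ball 0 r) ∧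
      Set.MapsTo G (ball 0 r) Ω ∧ Set.InjOn G (ball 0 r) ∧ G 0 = w ∧
      (∀ ξ, fderiv ℂ G 0 (fderiv ℂ Γ w ξ) = ξ) ∧
      complexJacobian Γ w * complexJacobian G 0 = 1 := by
    intro w hw
    obtain ⟨Γ, G, hΓ, hinj, hmaps, hΓw, hG, hGm, hinv⟩ := hsq w hw
    have h0r : (0 : Fin n → ℂ) ∈ ball 0 r := mem_ball_self hr
    have hG0 : G 0 = w := hinj (hGm h0r) hw (by rw [hinv 0 h0r, hΓw])
    have hcomp : (fderiv ℂ Γ w).comp (fderiv ℂ G 0) = ContinuousLinearMap.id ℂ (Fin n → ℂ) := by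
      have h1 : HasFDerivAt Γ (fderiv ℂ Γ w) (G 0) := by
        rw [hG0]
        exact (hΓ.differentiableAt (hΩ.mem_nhds hw)).hasFDerivAt
      have h2 := h1.comp 0 (hG.differentiableAt (ball_mem_nhds 0 hr)).hasFDerivAt
      have he : Γ ∘ G =ᶠ[𝓝 0] id := by
        filter_upwards [ball_mem_nhds (0 : Fin n → ℂ) hr] with u hu using hinv u hu
      rw [← h2.fderiv, he.fderiv_eq, fderiv_id]
    have hlin : (fderiv ℂ Γ w).toLinearMap * (fderiv ℂ G 0).toLinearMap = 1 :=
      congrArg ContinuousLinearMap.toLinearMap hcomp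
    refine ⟨Γ, G, hΓ, hinj, hmaps, hΓw, hG, hGm, ?_, hG0, fun ξ => ?_, ?_⟩
    · intro a ha b hb hab
      rw [← hinv a ha, ← hinv b hb, hab]
    -- In finite dimension a right inverse of the differential is also a left inverse.
    · exact congrArg (fun L => L ξ) (mul_eq_one_comm.mp hlin)
    · have := congrArg LinearMap.det hlin
      rwa [map_mul, map_one] at this
  have hproj : ∀ w ∈ Ω, ∀ Γ : (Fin n → ℂ) → Fin n → ℂ, DifferentiableOn ℂ Γ Ω →
      Set.InjOn Γ Ω → Set.MapsTo Γ Ω (ball 0 R) → Γ w = 0 → ∀ ξ, ∃ f : bergmanSpace Ω,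
        ‖f‖ ≤ M ∧ bergmanSpace.toFun f w = 0 ∧ ‖fderiv ℂ (bergmanSpace.toFun f) w ξ‖ =
          ‖fderiv ℂ Γ w ξ‖ * ‖complexJacobian Γ w‖ := by
    intro w hw Γ hΓ hinj hmaps hΓw ξ
    by_cases hu : fderiv ℂ Γ w ξ = 0
    · refine ⟨0, by simpa using hM.le, ?_⟩
      have h0 : Set.EqOn (bergmanSpace.toFun (0 : bergmanSpace Ω)) 0 Ω :=
        bergmanSpace.eqOn_toFun hΩ (differentiableOn_const 0) (Lp.coeFn_zero ℂ 2 _)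
      refine ⟨h0 hw, ?_⟩
      rw [(h0.eventuallyEq_of_mem (hΩ.mem_nhds hw)).fderiv_eq, hu]
      simp
    -- The coordinate realizing the sup norm of `fderiv ℂ Γ w ξ`, so that a single function detects
    -- its full length.
    obtain ⟨i, hi⟩ : ∃ i, ‖fderiv ℂ Γ w ξ i‖ = ‖fderiv ℂ Γ w ξ‖ := by
      by_contra! hne
      exact lt_irrefl _ ((pi_norm_lt_iff (norm_pos_iff.mpr hu)).mpr fun i =>
        lt_of_le_of_ne (norm_le_pi_norm _ i) (hne i))
    obtain ⟨f, hfM, hf⟩ := hlow Ω Γ (fun u => u i) hΩ hΓ hinj hmaps (by fun_prop)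
      (fun u hu => (norm_le_pi_norm u i).trans (mem_ball_zero_iff.mp hu).le)
    refine ⟨f, hfM, ?_, ?_⟩
    · rw [hf hw]
      simp [hΓw]
    · have hd := hΓ.differentiableAt (hΩ.mem_nhds hw)
      have hdi : HasFDerivAt (fun z => Γ z i)
          ((ContinuousLinearMap.proj i).comp (fderiv ℂ Γ w)) w :=
        hasFDerivAt_pi'.mp hd.hasFDerivAt i
      have hJ := (differentiableOn_complexJacobian hΩ hΓ).differentiableAt (hΩ.mem_nhds hw)
      rw [(hf.eventuallyEq_of_mem (hΩ.mem_nhds hw)).fderiv_eq,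
        fderiv_fun_mul hdi.differentiableAt hJ, hdi.fderiv]
      simp only [hΓw, add_apply, smul_apply, Pi.zero_apply, smul_eq_mul,
        ContinuousLinearMap.comp_apply, ContinuousLinearMap.proj_apply]
      rw [zero_mul, zero_add, norm_mul, hi, mul_comm]
  have hupper : ∀ w ∈ Ω, ∀ G : (Fin n → ℂ) → Fin n → ℂ, DifferentiableOn ℂ G (ball 0 r) →
      Set.MapsTo G (ball 0 r) Ω → Set.InjOn G (ball 0 r) → G 0 = w → ∀ f : bergmanSpace Ω,
      ‖complexJacobian G 0‖ * ‖bergmanSpace.toFun f w‖ ≤ C * ‖f‖ ∧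
      (bergmanSpace.toFun f w = 0 → fderiv ℂ (bergmanSpace.toFun f) w = 0 → ∀ u,
        ‖complexJacobian G 0‖ * ‖fderiv ℂ (fderiv ℂ (bergmanSpace.toFun f)) w
          (fderiv ℂ G 0 u) (fderiv ℂ G 0 u)‖ ≤ 16 * (C * ‖f‖) / (r / 2) ^ 2 * ‖u‖ * ‖u‖) := by
    intro w hw G hG hGm hGi hG0 f
    obtain ⟨hd, hb⟩ := hup Ω G f hG hGi hGm
    refine ⟨?_, fun hf0 hf1 u => ?_⟩
    · have := hb 0 (mem_ball_self (by positivity))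
      rwa [norm_mul, hG0] at this
    · rw [← hG0] at hf0 hf1 ⊢
      rw [← norm_mul, ← fderiv_fderiv_mul_comp isOpen_ball hΩ (mem_ball_self hr)
        (differentiableOn_complexJacobian isOpen_ball hG) hG hGm
        (bergmanSpace.differentiableOn_toFun f) hf0 hf1]
      exact norm_fderiv_fderiv_le (hd.mono (ball_subset_ball (by linarith))) hb (by positivity) u u
  -- With `a * b = 1` for the Jacobians of `Γ` and `G`: the second derivative contributes `16 * C /
  -- (r / 2) ^ 2` and the kernel another `C`, each divided by `b`; normalizing the test function by
  -- `M` contributes `M ^ 2`, and `a ^ 2` is absorbed in the square of its derivative.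
  refine bergman_boundedCurvature_of_jets (C := 16 * C / (r / 2) ^ 2 * C * M ^ 2) hΩ ?_ ?_
    (by positivity) ?_
  · intro w hw
    obtain ⟨Γ, G, hΓ, hinj, hmaps, -, -, -, -, -, -, hJ⟩ := hcoord w hw
    obtain ⟨f, -, hf⟩ := hlow1 Ω Γ (fun _ => 1) hΩ hΓ hinj hmaps (differentiableOn_const _)
      (fun u _ => by simp)
    refine ⟨f, ?_⟩
    rw [hf hw]
    simp only [one_mul]
    exact left_ne_zero_of_mul_eq_one hJ
  · intro w hw ξ hξ
    obtain ⟨Γ, G, hΓ, hinj, hmaps, hΓw, -, -, -, -, hGΓ, hJ⟩ := hcoord w hw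
    obtain ⟨f, -, hf0, hf⟩ := hproj w hw Γ hΓ hinj hmaps hΓw ξ
    refine ⟨f, hf0, norm_ne_zero_iff.mp ?_⟩
    rw [hf]
    refine mul_ne_zero (norm_ne_zero_iff.mpr fun h => hξ ?_)
      (norm_ne_zero_iff.mpr (left_ne_zero_of_mul_eq_one hJ))
    rw [← hGΓ ξ, h, map_zero]
  · intro w hw f hf0 hf1 ξ
    obtain ⟨Γ, G, hΓ, hinj, hmaps, hΓw, hG, hGm, hGi, hG0, hGΓ, hJ⟩ := hcoord w hw
    obtain ⟨h, hhM, hh0, hh⟩ := hproj w hw Γ hΓ hinj hmaps hΓw ξ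
    have hsm := bergmanSpace.eqOn_toFun_smul hΩ (M : ℂ)⁻¹ h
    refine ⟨(M : ℂ)⁻¹ • h, ?_, ?_, fun k hk => ?_⟩
    · rw [norm_smul, norm_inv, Complex.norm_real, Real.norm_of_nonneg hM.le, inv_mul_le_one₀ hM]
      exact hhM
    · rw [hsm hw, Pi.smul_apply, hh0, smul_zero]
    have hder : ‖fderiv ℂ (bergmanSpace.toFun ((M : ℂ)⁻¹ • h)) w ξ‖ =
        M⁻¹ * (‖fderiv ℂ Γ w ξ‖ * ‖complexJacobian Γ w‖) := by
      rw [(hsm.eventuallyEq_of_mem (hΩ.mem_nhds hw)).fderiv_eq, fderiv_const_smul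
        ((bergmanSpace.differentiableOn_toFun h).differentiableAt (hΩ.mem_nhds hw)), smul_apply,
        norm_smul, norm_inv, Complex.norm_real, Real.norm_of_nonneg hM.le, hh]
    have h2 := (hupper w hw G hG hGm hGi hG0 f).2 hf0 hf1 (fderiv ℂ Γ w ξ)
    have h3 := (hupper w hw G hG hGm hGi hG0 k).1
    rw [hGΓ] at h2
    have hJn : ‖complexJacobian Γ w‖ * ‖complexJacobian G 0‖ = 1 := by
      rw [← norm_mul, hJ, norm_one]
    rw [hder]
    set a := ‖complexJacobian Γ w‖
    set b := ‖complexJacobian G 0‖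
    set D := ‖fderiv ℂ (fderiv ℂ (bergmanSpace.toFun f)) w ξ ξ‖
    set K := ‖bergmanSpace.toFun k w‖
    set u := ‖fderiv ℂ Γ w ξ‖
    have h3' : b * K ≤ C := h3.trans (mul_le_of_le_one_right hC.le hk)
    calc D * K = (a * b) ^ 2 * (D * K) := by rw [hJn]; ring
      _ = a ^ 2 * ((b * D) * (b * K)) := by ring
      _ ≤ a ^ 2 * ((16 * (C * ‖f‖) / (r / 2) ^ 2 * u * u) * C) := by gcongr
      _ = _ := by field_simp

end Squeezing

/-! ### Disc automorphisms in one coordinate, extended by powers of the derivative. -/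

section MobiusShear

open Metric

/-- The disc automorphism moving `a` to the origin. -/
noncomputable def discMobius (a t : ℂ) : ℂ := (t - a) / (1 - conj a * t)

/-- The factor `((1 - |a|²)^(1/2) / (1 - ā t))^e`. -/
noncomputable def mobiusFactor (e : ℝ) (a t : ℂ) : ℂ :=
  Complex.exp (e * (Real.log (1 - ‖a‖ ^ 2) / 2 - Complex.log (1 - conj a * t)))

variable {a t : ℂ}

/-- The real part is positive, so the principal logarithm is holomorphic here and arbitrary real
powers make sense. -/
theorem one_sub_conj_mul_mem_slitPlane (ha : ‖a‖ < 1) (ht : ‖t‖ < 1) :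
    1 - conj a * t ∈ Complex.slitPlane := by
  refine Or.inl ?_
  have h1 : (conj a * t).re ≤ ‖a‖ * ‖t‖ := by
    refine (Complex.re_le_norm _).trans_eq ?_
    rw [norm_mul, RCLike.norm_conj]
  have h2 : ‖a‖ * ‖t‖ < 1 := by nlinarith [norm_nonneg a, norm_nonneg t]
  simp only [Complex.sub_re, Complex.one_re]
  linarith

theorem one_sub_norm_sq_pos (ha : ‖a‖ < 1) : 0 < 1 - ‖a‖ ^ 2 := by
  nlinarith [norm_nonneg a]

theorem one_sub_norm_discMobius_sq (ha : ‖a‖ < 1) (ht : ‖t‖ < 1) :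
    1 - ‖discMobius a t‖ ^ 2 =
      (1 - ‖a‖ ^ 2) * (1 - ‖t‖ ^ 2) / ‖1 - conj a * t‖ ^ 2 := by
  have hq := Complex.slitPlane_ne_zero (one_sub_conj_mul_mem_slitPlane ha ht)
  have hq' : ‖1 - conj a * t‖ ≠ 0 := norm_ne_zero_iff.mpr hq
  rw [discMobius, norm_div, div_pow, eq_div_iff (by positivity), sub_mul,
    div_mul_cancel₀ _ (by positivity)]
  simp only [← Complex.normSq_eq_norm_sq, Complex.normSq_apply, Complex.sub_re, Complex.sub_im,
    Complex.mul_re, Complex.mul_im, Complex.conj_re, Complex.conj_im, Complex.one_re,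
    Complex.one_im]
  ring

theorem norm_discMobius_lt_one (ha : ‖a‖ < 1) (ht : ‖t‖ < 1) : ‖discMobius a t‖ < 1 := by
  have hq := norm_pos_iff.mpr (Complex.slitPlane_ne_zero (one_sub_conj_mul_mem_slitPlane ha ht))
  have h : 0 < 1 - ‖discMobius a t‖ ^ 2 := by
    rw [one_sub_norm_discMobius_sq ha ht]
    have := one_sub_norm_sq_pos ha
    have := one_sub_norm_sq_pos ht
    positivity
  nlinarith [norm_nonneg (discMobius a t)]

theorem one_sub_conj_neg_mul_discMobius (ha : ‖a‖ < 1) (ht : ‖t‖ < 1) :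
    1 - conj (-a) * discMobius a t = ((1 - ‖a‖ ^ 2 : ℝ) : ℂ) * (1 - conj a * t)⁻¹ := by
  have hq := Complex.slitPlane_ne_zero (one_sub_conj_mul_mem_slitPlane ha ht)
  have h : (((1 - ‖a‖ ^ 2 : ℝ)) : ℂ) = 1 - conj a * a := by
    rw [← Complex.normSq_eq_norm_sq]
    push_cast
    rw [Complex.normSq_eq_conj_mul_self]
  rw [h, discMobius, map_neg]
  field_simp
  ring

theorem discMobius_neg_discMobius (ha : ‖a‖ < 1) (ht : ‖t‖ < 1) :
    discMobius (-a) (discMobius a t) = t := by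
  have hq := Complex.slitPlane_ne_zero (one_sub_conj_mul_mem_slitPlane ha ht)
  have hs : 1 - conj a * a ≠ 0 := by
    have h : (((1 - ‖a‖ ^ 2 : ℝ)) : ℂ) = 1 - conj a * a := by
      rw [← Complex.normSq_eq_norm_sq]
      push_cast
      rw [Complex.normSq_eq_conj_mul_self]
    rw [← h]
    exact_mod_cast (one_sub_norm_sq_pos ha).ne'
  have hs' : 1 - conj (-a) * discMobius a t = (1 - conj a * a) / (1 - conj a * t) := by
    rw [discMobius, map_neg]
    field_simp
    ring
  have ht' : discMobius a t - -a = t * (1 - conj a * a) / (1 - conj a * t) := by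
    rw [discMobius, eq_div_iff hq, sub_mul, div_mul_cancel₀ _ hq]
    ring
  rw [discMobius, hs', ht', div_div_div_cancel_right₀ hq, mul_div_cancel_right₀ _ hs]

/-- The chain rule for the automorphism and its inverse, raised to a real power. No multiple of
`2πi` appears because the principal logarithms add exactly. -/
theorem mobiusFactor_mul_mobiusFactor_neg (e : ℝ) (ha : ‖a‖ < 1) (ht : ‖t‖ < 1) :
    mobiusFactor e a t * mobiusFactor e (-a) (discMobius a t) = 1 := by
  have hsl := one_sub_conj_mul_mem_slitPlane ha ht
  have hlog : Complex.log (1 - conj (-a) * discMobius a t) =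
      Real.log (1 - ‖a‖ ^ 2) - Complex.log (1 - conj a * t) := by
    rw [one_sub_conj_neg_mul_discMobius ha ht, Complex.log_ofReal_mul (one_sub_norm_sq_pos ha)
      (inv_ne_zero (Complex.slitPlane_ne_zero hsl)),
      Complex.log_inv _ (Complex.slitPlane_arg_ne_pi hsl)]
    rfl
  rw [mobiusFactor, mobiusFactor, ← Complex.exp_add, hlog, norm_neg, Complex.exp_eq_one_iff]
  refine ⟨0, ?_⟩
  push_cast
  ring

/-- Both sides are the power `e` of the modulus of the derivative of the automorphism, by the
Schwarz-Pick identity. -/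
theorem norm_mobiusFactor_sq (e : ℝ) (ha : ‖a‖ < 1) (ht : ‖t‖ < 1) :
    ‖mobiusFactor e a t‖ ^ 2 = ((1 - ‖discMobius a t‖ ^ 2) / (1 - ‖t‖ ^ 2)) ^ e := by
  have hq := norm_pos_iff.mpr (Complex.slitPlane_ne_zero (one_sub_conj_mul_mem_slitPlane ha ht))
  have ha' := one_sub_norm_sq_pos ha
  have ht' := one_sub_norm_sq_pos ht
  have h1 : (1 - ‖discMobius a t‖ ^ 2) / (1 - ‖t‖ ^ 2) =
      (1 - ‖a‖ ^ 2) / ‖1 - conj a * t‖ ^ 2 := by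
    rw [one_sub_norm_discMobius_sq ha ht]
    field_simp
  rw [h1, Real.rpow_def_of_pos (by positivity), Real.log_div ha'.ne' (by positivity),
    Real.log_pow, mobiusFactor, Complex.norm_exp, ← Real.exp_nat_mul]
  congr 1
  have h2 : (e * (Real.log (1 - ‖a‖ ^ 2) / 2 - Complex.log (1 - conj a * t)) : ℂ).re =
      e * (Real.log (1 - ‖a‖ ^ 2) / 2 - Real.log ‖1 - conj a * t‖) := by
    rw [Complex.re_ofReal_mul, Complex.sub_re, Complex.log_re]
    congr 2
    rw [← Complex.ofReal_ofNat, ← Complex.ofReal_div, Complex.ofReal_re]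
  rw [h2]
  push_cast
  ring

/-- The map acting on the `i`-th coordinate by a disc automorphism and multiplying the other
coordinates by powers of its derivative. -/
noncomputable def mobiusShear (i : Fin 3) (e : Fin 3 → ℝ) (a : ℂ) (v : Fin 3 → ℂ) : Fin 3 → ℂ :=
  fun j => if j = i then discMobius a (v i) else v j * mobiusFactor (e j) a (v i)

variable {i j : Fin 3} {e : Fin 3 → ℝ} {v : Fin 3 → ℂ}

theorem mobiusShear_apply_self (i : Fin 3) (e : Fin 3 → ℝ) (a : ℂ) (v : Fin 3 → ℂ) :
    mobiusShear i e a v i = discMobius a (v i) :=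
  if_pos rfl

theorem mobiusShear_apply_of_ne (hij : j ≠ i) (e : Fin 3 → ℝ) (a : ℂ) (v : Fin 3 → ℂ) :
    mobiusShear i e a v j = v j * mobiusFactor (e j) a (v i) :=
  if_neg hij

theorem norm_mobiusShear_sq (hij : j ≠ i) (e : Fin 3 → ℝ) (ha : ‖a‖ < 1) (hv : ‖v i‖ < 1) :
    ‖mobiusShear i e a v j‖ ^ 2 =
      ‖v j‖ ^ 2 * ((1 - ‖mobiusShear i e a v i‖ ^ 2) / (1 - ‖v i‖ ^ 2)) ^ e j := by
  rw [mobiusShear_apply_of_ne hij, mobiusShear_apply_self, norm_mul, mul_pow,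
    norm_mobiusFactor_sq _ ha hv]

theorem mobiusShear_neg_mobiusShear (ha : ‖a‖ < 1) (hv : ‖v i‖ < 1) :
    mobiusShear i e (-a) (mobiusShear i e a v) = v := by
  ext j
  by_cases hij : j = i
  · subst hij
    rw [mobiusShear_apply_self, mobiusShear_apply_self, discMobius_neg_discMobius ha hv]
  · rw [mobiusShear_apply_of_ne hij, mobiusShear_apply_self, mobiusShear_apply_of_ne hij, mul_assoc,
      mobiusFactor_mul_mobiusFactor_neg _ ha hv, mul_one]

theorem differentiableOn_mobiusShear (i : Fin 3) (e : Fin 3 → ℝ) (ha : ‖a‖ < 1) :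
    DifferentiableOn ℂ (mobiusShear i e a) {v | ‖v i‖ < 1} := by
  have hsl : ∀ v ∈ {v : Fin 3 → ℂ | ‖v i‖ < 1}, 1 - conj a * v i ∈ Complex.slitPlane :=
    fun v hv => one_sub_conj_mul_mem_slitPlane ha hv
  have hq : DifferentiableOn ℂ (fun v : Fin 3 → ℂ => 1 - conj a * v i) {v | ‖v i‖ < 1} := by
    fun_prop
  refine differentiableOn_pi.mpr fun j => ?_
  by_cases hij : j = i
  · subst hij
    simp only [mobiusShear_apply_self, discMobius, div_eq_mul_inv]
    exact (DifferentiableOn.sub_const (by fun_prop) a).fun_mul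
      (hq.fun_inv fun v hv => Complex.slitPlane_ne_zero (hsl v hv))
  · simp only [mobiusShear_apply_of_ne hij, mobiusFactor]
    exact DifferentiableOn.fun_mul (by fun_prop)
      (((hq.clog hsl).const_sub _).const_mul _).cexp

theorem mobiusShear_self_apply_self (i : Fin 3) (e : Fin 3 → ℝ) (v : Fin 3 → ℂ) :
    mobiusShear i e (v i) v i = 0 := by
  rw [mobiusShear_apply_self, discMobius, sub_self, zero_div]

theorem mobiusShear_apply_eq_zero (hij : j ≠ i) (hj : v j = 0) : mobiusShear i e a v j = 0 := by
  rw [mobiusShear_apply_of_ne hij, hj, zero_mul]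

end MobiusShear

/-! ### The comparison domains, their automorphisms, and squeezing of `domainE`. -/

section EggDomain

open Metric

/-- Bernoulli's inequality for `q ≤ 1`, monotonicity in the exponent for `1 ≤ q`. Together with the
next bound it shows that near the boundary a power can be replaced by its base at the cost of a
constant, which yields all the inclusions below. -/
theorem min_mul_one_sub_le_one_sub_rpow {s q : ℝ} (hs : 0 ≤ s) (hs1 : s ≤ 1) (hq : 0 < q) :
    min 1 q * (1 - s) ≤ 1 - s ^ q := by
  rcases le_total 1 q with h | h
  · rw [min_eq_left h]
    have := Real.rpow_le_rpow_of_exponent_ge' hs hs1 zero_le_one h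
    rw [Real.rpow_one] at this
    linarith
  · rw [min_eq_right h]
    have := rpow_one_add_le_one_add_mul_self (s := s - 1) (by linarith) hq.le h
    rw [add_sub_cancel] at this
    linarith

theorem one_sub_rpow_le_max_mul_one_sub {s q : ℝ} (hs : 0 ≤ s) (hs1 : s ≤ 1) (hq : 0 < q) :
    1 - s ^ q ≤ max 1 q * (1 - s) := by
  rcases le_total 1 q with h | h
  · rw [max_eq_right h]
    have := one_add_mul_self_le_rpow_one_add (s := s - 1) (by linarith) h
    rw [add_sub_cancel] at this
    linarith
  · rw [max_eq_left h]
    have := Real.rpow_le_rpow_of_exponent_ge' hs hs1 hq.le h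
    rw [Real.rpow_one] at this
    linarith

/-- One scale `t` governs all coordinates, so invariance of a domain becomes a matching of
exponents. -/
theorem exists_norm_mobiusShear_sq {i : Fin 3} {a : ℂ} {v : Fin 3 → ℂ} (e : Fin 3 → ℝ)
    (ha : ‖a‖ < 1) (hv : ‖v i‖ < 1) :
    ∃ t > 0, 1 - ‖mobiusShear i e a v i‖ ^ 2 = (1 - ‖v i‖ ^ 2) * t ∧
      ∀ j ≠ i, ‖mobiusShear i e a v j‖ ^ 2 = ‖v j‖ ^ 2 * t ^ e j := by
  have h := one_sub_norm_sq_pos hv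
  have h' : 0 < 1 - ‖mobiusShear i e a v i‖ ^ 2 := by
    rw [mobiusShear_apply_self]
    exact one_sub_norm_sq_pos (norm_discMobius_lt_one ha hv)
  exact ⟨_, div_pos h' h, (mul_div_cancel₀ _ h.ne').symm,
    fun j hj => norm_mobiusShear_sq hj e ha hv⟩

/-- The domain `|x|^{2p} + |y|² + c |z|² < 1`. -/
def eggDomain (p c : ℝ) : Set (Fin 3 → ℂ) :=
  {v | (‖v 0‖ ^ 2) ^ p + ‖v 1‖ ^ 2 + c * ‖v 2‖ ^ 2 < 1}

/-- The domain `|x|² + c (|y|² + |z|²) < 1`. -/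
def ellipsoid (c : ℝ) : Set (Fin 3 → ℂ) :=
  {v | ‖v 0‖ ^ 2 + c * (‖v 1‖ ^ 2 + ‖v 2‖ ^ 2) < 1}

variable {p lam c : ℝ} {a : ℂ} {v : Fin 3 → ℂ}

theorem norm_lt_one_of_sq_lt_one {t : ℂ} (ht : ‖t‖ ^ 2 < 1) : ‖t‖ < 1 :=
  (sq_lt_one_iff₀ (norm_nonneg t)).mp ht

theorem mem_domainE_iff :
    v ∈ domainE p lam ↔
      ((‖v 0‖ ^ 2) ^ p + ‖v 1‖ ^ 2) ^ (1 / lam) + ‖v 2‖ ^ 2 < 1 := by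
  rw [domainE, Set.mem_ofPred_eq, Real.rpow_mul (norm_nonneg _), Real.rpow_ofNat]

theorem norm_apply_two_lt_one (hv : v ∈ domainE p lam) : ‖v 2‖ < 1 := by
  rw [mem_domainE_iff] at hv
  refine norm_lt_one_of_sq_lt_one ?_
  have : 0 ≤ ((‖v 0‖ ^ 2) ^ p + ‖v 1‖ ^ 2) ^ (1 / lam) := by positivity
  linarith

theorem mem_domainE_iff_lt_rpow (hlam : 0 < lam) (hv : ‖v 2‖ < 1) :
    v ∈ domainE p lam ↔ (‖v 0‖ ^ 2) ^ p + ‖v 1‖ ^ 2 < (1 - ‖v 2‖ ^ 2) ^ lam := by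
  rw [mem_domainE_iff, ← lt_sub_iff_add_lt, one_div,
    Real.rpow_inv_lt_iff_of_pos (by positivity) (one_sub_norm_sq_pos hv).le hlam]

/-- The exponents make `|x|^{2p}`, `|y|²` and `(1 - |z|²)^lam` all scale by `t ^ lam`. -/
theorem mobiusShear_mem_domainE {e : Fin 3 → ℝ} (hlam : 0 < lam)
    (h0 : e 0 * p = lam) (h1 : e 1 = lam) (ha : ‖a‖ < 1) (hv : v ∈ domainE p lam) :
    mobiusShear 2 e a v ∈ domainE p lam := by
  have hv2 := norm_apply_two_lt_one hv
  obtain ⟨t, ht, h2, hj⟩ := exists_norm_mobiusShear_sq e ha hv2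
  have hm : ‖mobiusShear 2 e a v 2‖ < 1 := by
    rw [mobiusShear_apply_self]
    exact norm_discMobius_lt_one ha hv2
  rw [mem_domainE_iff_lt_rpow hlam hv2] at hv
  rw [mem_domainE_iff_lt_rpow hlam hm, h2, hj 0 (by decide), hj 1 (by decide),
    Real.mul_rpow (by positivity) (by positivity), ← Real.rpow_mul ht.le, h0, h1,
    Real.mul_rpow (one_sub_norm_sq_pos hv2).le ht.le, ← add_mul]
  exact mul_lt_mul_of_pos_right hv (by positivity)

theorem norm_apply_one_lt_one_of_mem_eggDomain (hc : 0 < c) (hv : v ∈ eggDomain p c) :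
    ‖v 1‖ < 1 := by
  refine norm_lt_one_of_sq_lt_one ?_
  have h0 : 0 ≤ (‖v 0‖ ^ 2) ^ p := by positivity
  have h2 : 0 ≤ c * ‖v 2‖ ^ 2 := by positivity
  rw [eggDomain, Set.mem_ofPred_eq] at hv
  linarith

/-- Here `|x|^{2p}`, `|z|²` and `1 - |y|²` all scale by `t`, for every `c`; one map therefore
preserves the inner and the outer domain at once. -/
theorem mobiusShear_mem_eggDomain {e : Fin 3 → ℝ} (hc : 0 < c)
    (h0 : e 0 * p = 1) (h2 : e 2 = 1) (ha : ‖a‖ < 1) (hv : v ∈ eggDomain p c) :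
    mobiusShear 1 e a v ∈ eggDomain p c := by
  obtain ⟨t, ht, h1, hj⟩ :=
    exists_norm_mobiusShear_sq e ha (norm_apply_one_lt_one_of_mem_eggDomain hc hv)
  rw [eggDomain, Set.mem_ofPred_eq] at hv ⊢
  rw [hj 0 (by decide), hj 2 (by decide), Real.mul_rpow (by positivity) (by positivity),
    ← Real.rpow_mul ht.le, h0, h2, Real.rpow_one]
  have := mul_lt_mul_of_pos_right hv ht
  linarith

theorem norm_apply_zero_lt_one_of_mem_ellipsoid (hc : 0 < c) (hv : v ∈ ellipsoid c) :
    ‖v 0‖ < 1 := by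
  refine norm_lt_one_of_sq_lt_one ?_
  have h2 : 0 ≤ c * (‖v 1‖ ^ 2 + ‖v 2‖ ^ 2) := by positivity
  rw [ellipsoid, Set.mem_ofPred_eq] at hv
  linarith

theorem mobiusShear_mem_ellipsoid {e : Fin 3 → ℝ} (hc : 0 < c)
    (h1 : e 1 = 1) (h2 : e 2 = 1) (ha : ‖a‖ < 1) (hv : v ∈ ellipsoid c) :
    mobiusShear 0 e a v ∈ ellipsoid c := by
  obtain ⟨t, ht, h0, hj⟩ :=
    exists_norm_mobiusShear_sq e ha (norm_apply_zero_lt_one_of_mem_ellipsoid hc hv)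
  rw [ellipsoid, Set.mem_ofPred_eq] at hv ⊢
  rw [hj 1 (by decide), hj 2 (by decide), h1, h2, Real.rpow_one]
  have := mul_lt_mul_of_pos_right hv ht
  linarith

theorem eggDomain_subset_domainE (hlam : 0 < lam) :
    eggDomain p (min 1 (1 / lam))⁻¹ ⊆ domainE p lam := by
  intro v hv
  rw [eggDomain, Set.mem_ofPred_eq] at hv
  rw [mem_domainE_iff]
  have hm : 0 < min 1 (1 / lam) := lt_min one_pos (by positivity)
  have hA : 0 ≤ (‖v 0‖ ^ 2) ^ p + ‖v 1‖ ^ 2 := by positivity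
  have hz : 0 ≤ (min 1 (1 / lam))⁻¹ * ‖v 2‖ ^ 2 := by positivity
  have h := min_mul_one_sub_le_one_sub_rpow hA (by linarith) (one_div_pos.mpr hlam)
  have h' := mul_lt_mul_of_pos_left (lt_sub_iff_add_lt'.mpr hv) hm
  rw [mul_inv_cancel_left₀ hm.ne'] at h'
  linarith

theorem domainE_subset_eggDomain (hlam : 0 < lam) :
    domainE p lam ⊆ eggDomain p (max 1 (1 / lam))⁻¹ := by
  intro v hv
  rw [mem_domainE_iff] at hv
  rw [eggDomain, Set.mem_ofPred_eq]
  have hm : 0 < max 1 (1 / lam) := lt_max_of_lt_left one_pos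
  have hA : 0 ≤ (‖v 0‖ ^ 2) ^ p + ‖v 1‖ ^ 2 := by positivity
  have hA1 : (‖v 0‖ ^ 2) ^ p + ‖v 1‖ ^ 2 < 1 := by
    by_contra! hge
    have := Real.one_le_rpow hge (one_div_pos.mpr hlam).le
    nlinarith [sq_nonneg ‖v 2‖]
  have h := one_sub_rpow_le_max_mul_one_sub hA hA1.le (one_div_pos.mpr hlam)
  rw [← lt_sub_iff_add_lt', inv_mul_lt_iff₀ hm]
  linarith

theorem ellipsoid_subset_eggDomain (hp : 0 < p) (hc : 1 ≤ c) :
    ellipsoid (c / min 1 p) ⊆ eggDomain p c := by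
  intro v hv
  rw [ellipsoid, Set.mem_ofPred_eq] at hv
  rw [eggDomain, Set.mem_ofPred_eq]
  have hm : 0 < min 1 p := lt_min one_pos hp
  have hz : 0 ≤ c / min 1 p * (‖v 1‖ ^ 2 + ‖v 2‖ ^ 2) := by positivity
  have h := min_mul_one_sub_le_one_sub_rpow (s := ‖v 0‖ ^ 2) (by positivity) (by linarith) hp
  have h' := mul_lt_mul_of_pos_left (lt_sub_iff_add_lt'.mpr hv) hm
  rw [← mul_assoc, mul_div_cancel₀ _ hm.ne'] at h'
  have h'' : ‖v 1‖ ^ 2 ≤ c * ‖v 1‖ ^ 2 := le_mul_of_one_le_left (by positivity) hc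
  linarith

theorem eggDomain_subset_ellipsoid (hp : 0 < p) (hc0 : 0 < c) (hc : c ≤ 1) :
    eggDomain p c ⊆ ellipsoid (c / max 1 p) := by
  intro v hv
  rw [eggDomain, Set.mem_ofPred_eq] at hv
  rw [ellipsoid, Set.mem_ofPred_eq]
  have hm : 0 < max 1 p := lt_max_of_lt_left one_pos
  have hz : 0 ≤ c * ‖v 2‖ ^ 2 := by positivity
  have hs1 : ‖v 0‖ ^ 2 < 1 := by
    by_contra! hge
    have := Real.one_le_rpow hge hp.le
    nlinarith [sq_nonneg ‖v 1‖]
  have h := one_sub_rpow_le_max_mul_one_sub (s := ‖v 0‖ ^ 2) (by positivity) hs1.le hp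
  have h'' : c * ‖v 1‖ ^ 2 ≤ ‖v 1‖ ^ 2 := mul_le_of_le_one_left (by positivity) hc
  rw [← lt_sub_iff_add_lt', div_mul_eq_mul_div, div_lt_iff₀ hm]
  linarith

theorem ball_subset_ellipsoid (hc : 0 < c) :
    ball (0 : Fin 3 → ℂ) (1 / (1 + 2 * c)) ⊆ ellipsoid c := by
  intro v hv
  have hr : 0 < 1 / (1 + 2 * c) := by positivity
  have hr1 : 1 / (1 + 2 * c) ≤ 1 := by
    rw [div_le_one (by positivity)]
    linarith
  have h : ∀ j, ‖v j‖ ^ 2 < 1 / (1 + 2 * c) := fun j => by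
    have := (pi_norm_lt_iff hr).mp (mem_ball_zero_iff.mp hv) j
    nlinarith [norm_nonneg (v j)]
  have hc' : 1 / (1 + 2 * c) + c * (1 / (1 + 2 * c) + 1 / (1 + 2 * c)) = 1 := by
    field_simp
    ring
  rw [ellipsoid, Set.mem_ofPred_eq, ← hc']
  gcongr
  exacts [h 0, h 1, h 2]

theorem ellipsoid_subset_ball (hc : 0 < c) :
    ellipsoid c ⊆ ball (0 : Fin 3 → ℂ) (1 + 1 / c) := by
  intro v hv
  have h0 := norm_apply_zero_lt_one_of_mem_ellipsoid hc hv
  rw [ellipsoid, Set.mem_ofPred_eq] at hv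
  have hcpos : 0 < 1 / c := by positivity
  have h : ∀ j, c * ‖v j‖ ^ 2 < 1 → ‖v j‖ < 1 + 1 / c := fun j hj => by
    rw [← lt_div_iff₀' hc] at hj
    -- A square root is avoided because `1 / c < (1 + 1 / c) ^ 2`.
    nlinarith [norm_nonneg (v j)]
  have h1 : 0 ≤ c * ‖v 1‖ ^ 2 := by positivity
  have h2 : 0 ≤ c * ‖v 2‖ ^ 2 := by positivity
  rw [mem_ball_zero_iff, pi_norm_lt_iff (by positivity), Fin.forall_fin_succ,
    Fin.forall_fin_two]
  exact ⟨h0.trans (by linarith), h 1 (by nlinarith), h 2 (by nlinarith)⟩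

theorem isOpen_domainE (hp : 0 < p) (hlam : 0 < lam) : IsOpen (domainE p lam) := by
  have h1 : Continuous fun v : Fin 3 → ℂ => ‖v 0‖ ^ (2 * p) :=
    Continuous.rpow_const (by fun_prop) fun _ => Or.inr (by positivity)
  have h2 : Continuous fun v : Fin 3 → ℂ => (‖v 0‖ ^ (2 * p) + ‖v 1‖ ^ 2) ^ (1 / lam) :=
    Continuous.rpow_const (by fun_prop) fun _ => Or.inr (by positivity)
  exact isOpen_lt (by fun_prop) continuous_const

theorem hasUniformSqueezing_domainE (hp : 0 < p) (hlam : 0 < lam) :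
    HasUniformSqueezing (domainE p lam)
      (1 / (1 + 2 * ((min 1 (1 / lam))⁻¹ / min 1 p)))
      (1 + 1 / ((max 1 (1 / lam))⁻¹ / max 1 p)) := by
  intro w hw
  set c₁ := (min 1 (1 / lam))⁻¹
  set c₂ := (max 1 (1 / lam))⁻¹
  have hc₁ : 1 ≤ c₁ := (one_le_inv₀ (lt_min one_pos (by positivity))).mpr (min_le_left _ _)
  have hc₂ : 0 < c₂ := inv_pos.mpr (lt_max_of_lt_left one_pos)
  have hc₂' : c₂ ≤ 1 := inv_le_one_of_one_le₀ (le_max_left _ _)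
  set c := c₁ / min 1 p
  set c' := c₂ / max 1 p
  have hc₁' : 0 < c₁ := one_pos.trans_le hc₁
  have hc : 0 < c := div_pos hc₁' (lt_min one_pos hp)
  have hc' : 0 < c' := div_pos hc₂ (lt_max_of_lt_left one_pos)
  -- The entry of each exponent vector at the distinguished coordinate is a dummy, as that
  -- coordinate is moved by the automorphism itself.
  set T := mobiusShear 2 ![lam / p, lam, 0]
  set S := mobiusShear 1 ![1 / p, 0, 1]
  set M := mobiusShear 0 ![0, 1, 1]
  have hT {a v} (ha : ‖a‖ < 1) (hv : v ∈ domainE p lam) : T a v ∈ domainE p lam :=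
    mobiusShear_mem_domainE hlam (div_mul_cancel₀ _ hp.ne') rfl ha hv
  have hS {b a v} (hb : 0 < b) (ha : ‖a‖ < 1) (hv : v ∈ eggDomain p b) :
      S a v ∈ eggDomain p b :=
    mobiusShear_mem_eggDomain hb (div_mul_cancel₀ _ hp.ne') rfl ha hv
  have hM {b a v} (hb : 0 < b) (ha : ‖a‖ < 1) (hv : v ∈ ellipsoid b) : M a v ∈ ellipsoid b :=
    mobiusShear_mem_ellipsoid hb rfl rfl ha hv
  have hT' {a v} (ha : ‖a‖ < 1) (hv : v ∈ domainE p lam) : T (-a) (T a v) = v :=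
    mobiusShear_neg_mobiusShear ha (norm_apply_two_lt_one hv)
  have hS' {b a v} (hb : 0 < b) (ha : ‖a‖ < 1) (hv : v ∈ eggDomain p b) : S (-a) (S a v) = v :=
    mobiusShear_neg_mobiusShear ha (norm_apply_one_lt_one_of_mem_eggDomain hb hv)
  have hM' {b a v} (hb : 0 < b) (ha : ‖a‖ < 1) (hv : v ∈ ellipsoid b) : M (-a) (M a v) = v :=
    mobiusShear_neg_mobiusShear ha (norm_apply_zero_lt_one_of_mem_ellipsoid hb hv)
  have hES : domainE p lam ⊆ eggDomain p c₂ := domainE_subset_eggDomain hlam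
  have hSM : eggDomain p c₂ ⊆ ellipsoid c' := eggDomain_subset_ellipsoid hp hc₂ hc₂'
  have hSE : eggDomain p c₁ ⊆ domainE p lam := eggDomain_subset_domainE hlam
  have hMS : ellipsoid c ⊆ eggDomain p c₁ := ellipsoid_subset_eggDomain hp hc₁
  have hball := ball_subset_ellipsoid hc
  have ha₂ : ‖w 2‖ < 1 := norm_apply_two_lt_one hw
  set w' := T (w 2) w
  have hw' : w' ∈ eggDomain p c₂ := hES (hT ha₂ hw)
  have ha₁ : ‖w' 1‖ < 1 := norm_apply_one_lt_one_of_mem_eggDomain hc₂ hw'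
  set w'' := S (w' 1) w'
  have hw'' : w'' ∈ ellipsoid c' := hSM (hS hc₂ ha₁ hw')
  have ha₀ : ‖w'' 0‖ < 1 := norm_apply_zero_lt_one_of_mem_ellipsoid hc' hw''
  have hTS {v} (hv : v ∈ domainE p lam) : T (w 2) v ∈ eggDomain p c₂ := hES (hT ha₂ hv)
  have hTM {v} (hv : v ∈ domainE p lam) : S (w' 1) (T (w 2) v) ∈ ellipsoid c' :=
    hSM (hS hc₂ ha₁ (hTS hv))
  have hna₂ : ‖-w 2‖ < 1 := by rwa [norm_neg]
  have hna₁ : ‖-w' 1‖ < 1 := by rwa [norm_neg]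
  have hna₀ : ‖-w'' 0‖ < 1 := by rwa [norm_neg]
  -- The inner chain only needs the parameters to lie in the unit disc; the points `w'` and `w''`
  -- need not lie in the inner domains.
  have hBS {u} (hu : u ∈ ball (0 : Fin 3 → ℂ) (1 / (1 + 2 * c))) :
      M (-w'' 0) u ∈ eggDomain p c₁ := hMS (hM hc hna₀ (hball hu))
  have hBT {u} (hu : u ∈ ball (0 : Fin 3 → ℂ) (1 / (1 + 2 * c))) :
      S (-w' 1) (M (-w'' 0) u) ∈ domainE p lam := hSE (hS hc₁' hna₁ (hBS hu))
  refine ⟨fun v => M (w'' 0) (S (w' 1) (T (w 2) v)),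
    fun u => T (-w 2) (S (-w' 1) (M (-w'' 0) u)), ?_, ?_, ?_, ?_, ?_, ?_, ?_⟩
  · exact (differentiableOn_mobiusShear 0 _ ha₀).comp
      ((differentiableOn_mobiusShear 1 _ ha₁).comp
        ((differentiableOn_mobiusShear 2 _ ha₂).mono fun v hv => norm_apply_two_lt_one hv)
        fun v hv => norm_apply_one_lt_one_of_mem_eggDomain hc₂ (hTS hv))
      fun v hv => norm_apply_zero_lt_one_of_mem_ellipsoid hc' (hTM hv)
  · refine Set.LeftInvOn.injOn (f₁' := fun u => T (-w 2) (S (-w' 1) (M (-w'' 0) u))) ?_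
    intro v hv
    change T (-w 2) (S (-w' 1) (M (-w'' 0) (M (w'' 0) (S (w' 1) (T (w 2) v))))) = v
    rw [hM' hc' ha₀ (hTM hv), hS' hc₂ ha₁ (hTS hv), hT' ha₂ hv]
  · exact fun v hv => ellipsoid_subset_ball hc' (hM hc' ha₀ (hTM hv))
  -- Each map centers one coordinate and multiplies the others by factors, so zeros already obtained
  -- persist.
  · have hw'2 : w' 2 = 0 := mobiusShear_self_apply_self 2 _ w
    have hw''1 : w'' 1 = 0 := mobiusShear_self_apply_self 1 _ w'
    have hw''2 : w'' 2 = 0 := mobiusShear_apply_eq_zero (by decide) hw'2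
    ext j
    fin_cases j
    exacts [mobiusShear_self_apply_self 0 _ w'', mobiusShear_apply_eq_zero (by decide) hw''1,
      mobiusShear_apply_eq_zero (by decide) hw''2]
  · exact (differentiableOn_mobiusShear 2 _ hna₂).comp
      ((differentiableOn_mobiusShear 1 _ hna₁).comp
        ((differentiableOn_mobiusShear 0 _ hna₀).mono fun u hu =>
          norm_apply_zero_lt_one_of_mem_ellipsoid hc (hball hu))
        fun u hu => norm_apply_one_lt_one_of_mem_eggDomain hc₁' (hBS hu))
      fun u hu => norm_apply_two_lt_one (hBT hu)
  · exact fun u hu => hT hna₂ (hBT hu)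
  · intro u hu
    have h2 := hT' hna₂ (hBT hu)
    have h1 := hS' hc₁' hna₁ (hBS hu)
    have h0 := hM' hc hna₀ (hball hu)
    rw [neg_neg] at h0 h1 h2
    change M (w'' 0) (S (w' 1) (T (w 2) (T (-w 2) (S (-w' 1) (M (-w'' 0) u))))) = u
    rw [h2, h1, h0]

end EggDomain

theorem mainTheorem3 (p lam : ℝ) (hp : 0 < p) (hlam : 0 < lam) :
    (∀ z ∈ domainE p lam, 0 < (bergmanKernel (domainE p lam) z z).re) ∧
    ContDiffOn ℝ ∞ (logBergmanKernel (domainE p lam)) (domainE p lam) ∧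
    (∀ z ∈ domainE p lam, (bergmanMetric (domainE p lam) z).PosDef) ∧
    HasBoundedCurvature (bergmanMetric (domainE p lam)) (domainE p lam) := by
  have h := hasUniformSqueezing_domainE hp hlam
  have h1 : 0 < min 1 p := lt_min one_pos hp
  have h2 : 0 < max 1 p := lt_max_of_lt_left one_pos
  have h3 : 0 < min 1 (1 / lam) := lt_min one_pos (by positivity)
  have h4 : 0 < max 1 (1 / lam) := lt_max_of_lt_left one_pos
  exact h.bergman_boundedCurvature (isOpen_domainE hp hlam) (by positivity) (by positivity)
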